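/- Let $M$ be a smooth manifold (Hausdorff, second countable, without boundary) of dimension $n\ge 3$, let $c$ be a conformal structure on $M$, i.e. an equivalence class of smooth semi-Riemannian metrics (of arbitrary signature), where $g\sim e^{2\sigma}g$ for smooth $\sigma:M\to\mathbb R$, and let $g\in c$. Let $\nabla$ be the Levi-Civita connection of $g$, and let $$\mathsf P=\tfrac1{n-2}\bigl(\mathrm{Ric}-\tfrac{\mathrm{scal}}{2(n-1)}\,g\bigr)$$ be its Schouten tensor, also regarded as an endomorphism of $TM$ by means of $g$. In the splitting determined by $g$, the standard tractor bundle is $\mathcal T=\underline{\mathbb R}\oplus TM\oplus\underline{\mathbb R}$, with the normal conformal tractor connection $$\nabla^{nc}_X(\alpha,Y,\beta)=\bigl(X(\alpha)-\mathsf P(X,Y),\ \nabla_XY+\alpha X+\beta\,\mathsf P(X),\ X(\beta)-g(X,Y)\bigr).$$ Let $\mathrm{Hol}_x(M,c)$ be the group of $\nabla^{nc}$-parallel transports along piecewise smooth loops based at $x\in M$, and let $\mathfrak{hol}_x(M,c)\subset\mathrm{End}(\mathcal T_x)$ be its Lie algebra. The conformal holonomy distribution is given by $$\mathcal E_x=\bigl\{X\in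 T_xM:\ \text{the endomorphism }(\alpha,Y,\beta)\mapsto(g(X,Y),\,-\beta X,\,0)\text{ of }\mathcal T_x\text{ lies in }\mathfrak{hol}_x(M,c)\bigr\}$$ (a linear subspace of $T_xM$, which does not depend on the choice of $g\in c$), and $r^{\mathcal E}(x):=\dim\mathcal E_x$. An open set $V\subset M$ is called $\mathcal E$-adapted if $r^{\mathcal E}$ is equal to a constant $k$ on $V$ and there are smooth vector fields $V_1,\dots,V_k$ on $V$ that are linearly independent at each point of $V$ and satisfy $V_i(x)\in\mathcal E_x$ for all $x\in V$. Then every non-empty open subset $U$ of $M$ contains a non-empty $\mathcal E$-adapted open subset $V$. In particular, the union of all $\mathcal E$-adapted open sets is open and dense in $M$. -/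

import Mathlib

open Set Filter Topology Bundle Manifold
open scoped ContDiff

noncomputable section

namespace ConfHol

/-! ### Semi-Riemannian metrics and conformal structures -/

/-- The model space `ℝⁿ` of the manifolds considered. -/
abbrev Model (n : ℕ) : Type := EuclideanSpace ℝ (Fin n)

/-- A smooth semi-Riemannian metric (of arbitrary signature) on an `n`-dimensional manifold. -/
structure SemiRiemannianMetric (n : ℕ) (M : Type*) [TopologicalSpace M]
    [ChartedSpace (Model n) M] [IsManifold (𝓡 n) ∞ M] where
  /-- The scalar product on each tangent space. -/
  val : ∀ x : M, TangentSpace (𝓡 n) x →L[ℝ] TangentSpace (𝓡 n) x →L[ℝ] ℝ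
  symm : ∀ (x : M) (v w : TangentSpace (𝓡 n) x), val x v w = val x w v
  nondegenerate : ∀ (x : M) (v : TangentSpace (𝓡 n) x), (∀ w, val x v w = 0) → v = 0
  contMDiff : ContMDiff (𝓡 n) ((𝓡 n).prod 𝓘(ℝ, Model n →L[ℝ] Model n →L[ℝ] ℝ)) ∞
    (fun x ↦ TotalSpace.mk' (Model n →L[ℝ] Model n →L[ℝ] ℝ)
      (E := fun x : M ↦ TangentSpace (𝓡 n) x →L[ℝ] TangentSpace (𝓡 n) x →L[ℝ] ℝ) x (val x))

section Manifold

variable {n : ℕ} {M : Type*} [TopologicalSpace M] [ChartedSpace (Model n) M]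
  [IsManifold (𝓡 n) ∞ M]

/-- `g' = e^{2σ} g` for a smooth function `σ`. -/
def ConformallyEquivalent (g g' : SemiRiemannianMetric n M) : Prop :=
  ∃ σ : M → ℝ, ContMDiff (𝓡 n) 𝓘(ℝ, ℝ) ∞ σ ∧
    ∀ (x : M) (v w : TangentSpace (𝓡 n) x),
      g'.val x v w = Real.exp (2 * σ x) * g.val x v w

/-- A set of metrics is a conformal structure if it is a conformal equivalence class. -/
def IsConformalStructure (c : Set (SemiRiemannianMetric n M)) : Prop :=
  ∃ g, c = {g' | ConformallyEquivalent g g'}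

end Manifold

/-! ### Coordinate expressions

For the Gram matrix `G = (g_ij)` of a metric, as a function of the coordinates `y`. -/

section Coordinates

variable {n : ℕ}

/-- The partial derivative `∂ₖ f` at `y`. -/
def partialDeriv (k : Fin n) (f : Model n → ℝ) (y : Model n) : ℝ :=
  fderiv ℝ f y (EuclideanSpace.single k 1)

variable (G : Model n → Matrix (Fin n) (Fin n) ℝ)

/-- Christoffel symbols of the Levi-Civita connection,
`Γᵏᵢⱼ = ½ gᵏˡ (∂ᵢ gⱼₗ + ∂ⱼ gᵢₗ - ∂ₗ gᵢⱼ)`. -/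
def christoffel (k i j : Fin n) (y : Model n) : ℝ :=
  (1 / 2) * ∑ l, (G y)⁻¹ k l *
    (partialDeriv i (fun z ↦ G z j l) y + partialDeriv j (fun z ↦ G z i l) y
      - partialDeriv l (fun z ↦ G z i j) y)

/-- The Ricci tensor `Ric(X,Y) = tr (Z ↦ R(Z,X)Y)`, where `R(X,Y) = [∇_X,∇_Y] - ∇_[X,Y]`. -/
def ricci (i j : Fin n) (y : Model n) : ℝ :=
  ∑ k, (partialDeriv k (christoffel G k i j) y - partialDeriv i (christoffel G k k j) y
    + ∑ m, (christoffel G k k m y * christoffel G m i j y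
      - christoffel G k i m y * christoffel G m k j y))

/-- The scalar curvature. -/
def scal (y : Model n) : ℝ := ∑ i, ∑ j, (G y)⁻¹ i j * ricci G i j y

/-- The Schouten tensor `P = (Ric - scal g / (2(n-1))) / (n-2)`. -/
def schouten (i j : Fin n) (y : Model n) : ℝ :=
  (1 / ((n : ℝ) - 2)) * (ricci G i j y - scal G y / (2 * ((n : ℝ) - 1)) * G y i j)

end Coordinates

/-! ### The standard tractor bundle and its normal connection -/

/-- The fibre at `x` of the standard tractor bundle in the splitting `ℝ ⊕ TM ⊕ ℝ` given by a
metric of the conformal class; `(α, Y, β)` stands for `α s₋ + Y + β s₊`. -/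
abbrev Tractor (n : ℕ) {M : Type*} [TopologicalSpace M] [ChartedSpace (Model n) M] (x : M) :
    Type := ℝ × TangentSpace (𝓡 n) x × ℝ

section Tractors

variable {n : ℕ} {M : Type*} [TopologicalSpace M] [ChartedSpace (Model n) M]
  [IsManifold (𝓡 n) ∞ M]

instance (x : M) : FiniteDimensional ℝ (TangentSpace (𝓡 n) x) :=
  inferInstanceAs (FiniteDimensional ℝ (Model n))

/-- The Gram matrix of `g` in the preferred chart at `x₀`, as a function of the coordinates. -/
def gram (g : SemiRiemannianMetric n M) (x₀ : M) (y : Model n) : Matrix (Fin n) (Fin n) ℝ :=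
  let ψ := (extChartAt (𝓡 n) x₀).symm
  fun i j ↦ g.val (ψ y) (mfderiv 𝓘(ℝ, Model n) (𝓡 n) ψ y (EuclideanSpace.single i (1 : ℝ)))
    (mfderiv 𝓘(ℝ, Model n) (𝓡 n) ψ y (EuclideanSpace.single j (1 : ℝ)))

/-- The components of a tangent vector at `x` in the preferred chart at `x₀`. -/
def components (x₀ x : M) (Y : TangentSpace (𝓡 n) x) : Fin n → ℝ :=
  fun k ↦ (show Model n from
    mfderiv (𝓡 n) 𝓘(ℝ, Model n) (extChartAt (𝓡 n) x₀) x Y) k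

/-- The equation `∇ⁿᶜ s = 0` at the parameter `t`, for a section `s = (α, Y, β)` along the curve
`γ : [0,1] → M`, written in the preferred chart at `x₀`. It is obtained from
`∇ⁿᶜ_X (α, Y, β) = (X(α) - P(X,Y), ∇_X Y + α X + β P(X), X(β) - g(X,Y))` with `X = γ'`. -/
def ParallelEquation (g : SemiRiemannianMetric n M) (x₀ : M) (γ : ℝ → M)
    (s : ∀ t, Tractor n (γ t)) (t : ℝ) : Prop :=
  let y : Model n := extChartAt (𝓡 n) x₀ (γ t)
  let c' : Model n := derivWithin (fun τ ↦ extChartAt (𝓡 n) x₀ (γ τ)) (Icc 0 1) t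
  let α : ℝ := (s t).1
  let Y : Fin n → ℝ := components x₀ (γ t) (s t).2.1
  let β : ℝ := (s t).2.2
  let G := gram g x₀
  HasDerivWithinAt (fun τ ↦ (s τ).1) (∑ i, ∑ j, schouten G i j y * c' i * Y j) (Icc 0 1) t ∧
  (∀ k, HasDerivWithinAt (fun τ ↦ components x₀ (γ τ) (s τ).2.1 k)
    (-(∑ i, ∑ j, christoffel G k i j y * c' i * Y j) - α * c' k
      - β * ∑ i, ∑ l, (G y)⁻¹ k l * schouten G i l y * c' i) (Icc 0 1) t) ∧
  HasDerivWithinAt (fun τ ↦ (s τ).2.2) (∑ i, ∑ j, G y i j * c' i * Y j) (Icc 0 1) t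

/-- A tractor field along `γ : [0,1] → M` is parallel for the normal tractor connection: every
parameter has a neighbourhood in which `γ` runs in a coordinate domain and the parallelism
equation holds in these coordinates. -/
def IsParallelAlong (g : SemiRiemannianMetric n M) (γ : ℝ → M)
    (s : ∀ t, Tractor n (γ t)) : Prop :=
  ∀ t₀ ∈ Icc (0 : ℝ) 1, ∃ x₀ : M, γ t₀ ∈ (chartAt (Model n) x₀).source ∧
    ∀ᶠ t in 𝓝[Icc 0 1] t₀, ParallelEquation g x₀ γ s t

/-- `B` is the parallel transport along the smooth curve `γ : [0,1] → M`. -/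
def IsTransportAlong (g : SemiRiemannianMetric n M) (γ : ℝ → M)
    (B : Tractor n (γ 0) ≃ₗ[ℝ] Tractor n (γ 1)) : Prop :=
  ContMDiffOn 𝓘(ℝ, ℝ) (𝓡 n) ∞ γ (Icc 0 1) ∧
    ∀ v, ∃ s : ∀ t, Tractor n (γ t), IsParallelAlong g γ s ∧ s 0 = v ∧ s 1 = B v

/-- `IsTransport g x y A`: the map `A` is the parallel transport along some piecewise smooth curve
from `x` to `y`, i.e. a composition of parallel transports along finitely many consecutive smooth
curves. -/
inductive IsTransport (g : SemiRiemannianMetric n M) (x : M) :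
    ∀ y : M, (Tractor n x ≃ₗ[ℝ] Tractor n y) → Prop
  | refl : IsTransport g x x (LinearEquiv.refl ℝ _)
  | step (γ : ℝ → M) (A : Tractor n x ≃ₗ[ℝ] Tractor n (γ 0))
      (B : Tractor n (γ 0) ≃ₗ[ℝ] Tractor n (γ 1)) :
      IsTransport g x (γ 0) A → IsTransportAlong g γ B → IsTransport g x (γ 1) (A.trans B)

theorem IsTransport.trans {g : SemiRiemannianMetric n M} {x y z : M}
    {A : Tractor n x ≃ₗ[ℝ] Tractor n y} {B : Tractor n y ≃ₗ[ℝ] Tractor n z}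
    (hA : IsTransport g x y A) (hB : IsTransport g y z B) : IsTransport g x z (A.trans B) := by
  induction hB with
  | refl => exact hA
  | step γ B C _ hC ih =>
    rw [← LinearEquiv.trans_assoc]
    exact .step γ _ C ih hC

theorem ParallelEquation.reverse {g : SemiRiemannianMetric n M} {x₀ : M} {γ : ℝ → M}
    {s : ∀ t, Tractor n (γ t)} {t : ℝ}
    (h : ParallelEquation g x₀ γ s (1 - t)) :
    ParallelEquation g x₀ (fun τ ↦ γ (1 - τ)) (fun τ ↦ s (1 - τ)) t := by
  have hmaps : MapsTo (fun τ : ℝ ↦ 1 - τ) (Icc 0 1) (Icc 0 1) := by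
    intro τ hτ
    simp only [mem_Icc] at hτ ⊢
    constructor <;> linarith [hτ.1, hτ.2]
  have hrev : HasDerivWithinAt (fun τ : ℝ ↦ 1 - τ) (-1) (Icc 0 1) t := by
    simpa using (hasDerivWithinAt_id t (Icc (0 : ℝ) 1)).const_sub 1
  have key : ∀ {f : ℝ → ℝ} {f' f'' : ℝ}, HasDerivWithinAt f f' (Icc 0 1) (1 - t) → f'' = -f' →
      HasDerivWithinAt (fun τ ↦ f (1 - τ)) f'' (Icc 0 1) t := by
    intro f f' f'' hf hf'
    have := HasDerivWithinAt.scomp t hf hrev hmaps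
    rw [hf']
    simpa [Function.comp_def] using this
  have hc : derivWithin (fun τ ↦ extChartAt (𝓡 n) x₀ (γ (1 - τ))) (Icc 0 1) t
      = -derivWithin (fun τ ↦ extChartAt (𝓡 n) x₀ (γ τ)) (Icc 0 1) (1 - t) := by
    have := derivWithin_comp_const_sub (f := fun τ ↦ extChartAt (𝓡 n) x₀ (γ τ))
      (s := Icc (0 : ℝ) 1) (x := t) (1 : ℝ)
    rw [this]
    simp
  obtain ⟨h1, h2, h3⟩ := h
  refine ⟨key h1 ?_, fun k ↦ key (h2 k) ?_, key h3 ?_⟩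
  all_goals
    simp only [hc, PiLp.neg_apply, mul_neg, neg_mul, Finset.sum_neg_distrib]
  ring

theorem IsParallelAlong.reverse {g : SemiRiemannianMetric n M} {γ : ℝ → M}
    {s : ∀ t, Tractor n (γ t)} (h : IsParallelAlong g γ s) :
    IsParallelAlong g (fun τ ↦ γ (1 - τ)) (fun τ ↦ s (1 - τ)) := by
  intro t₀ ht₀
  obtain ⟨x₀, hx₀, hev⟩ := h (1 - t₀) ⟨by linarith [ht₀.2], by linarith [ht₀.1]⟩
  refine ⟨x₀, hx₀, ?_⟩
  have htend : Tendsto (fun τ : ℝ ↦ 1 - τ) (𝓝[Icc 0 1] t₀) (𝓝[Icc 0 1] (1 - t₀)) := by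
    refine tendsto_nhdsWithin_of_tendsto_nhds_of_eventually_within _ ?_ ?_
    · exact ((continuous_const.sub continuous_id).tendsto t₀).mono_left nhdsWithin_le_nhds
    · filter_upwards [self_mem_nhdsWithin] with τ hτ
      exact ⟨by linarith [hτ.2], by linarith [hτ.1]⟩
  filter_upwards [htend.eventually hev] with τ h1
  exact h1.reverse

/-- A form of `IsTransport.step` for a curve whose end points are only propositionally known. -/
theorem IsTransport.of_curve {g : SemiRiemannianMetric n M} {y z : M} (γ : ℝ → M)
    (h0 : γ 0 = y) (h1 : γ 1 = z) (hγ : ContMDiffOn 𝓘(ℝ, ℝ) (𝓡 n) ∞ γ (Icc 0 1))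
    (B : Tractor n y ≃ₗ[ℝ] Tractor n z)
    (hB : ∀ v, ∃ s : ∀ t, Tractor n (γ t), IsParallelAlong g γ s ∧ HEq (s 0) v ∧ HEq (s 1) (B v)) :
    IsTransport g y z B := by
  subst h0 h1
  have := IsTransport.step γ (LinearEquiv.refl ℝ _) B (.refl (g := g)) ⟨hγ, fun v ↦ by
    obtain ⟨s, hs, h0, h1⟩ := hB v
    exact ⟨s, hs, eq_of_heq h0, eq_of_heq h1⟩⟩
  simpa using this

theorem IsTransport.symm {g : SemiRiemannianMetric n M} {x y : M}
    {A : Tractor n x ≃ₗ[ℝ] Tractor n y} (hA : IsTransport g x y A) :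
    IsTransport g y x A.symm := by
  induction hA with
  | refl => exact .refl
  | step γ A B _ hB ih =>
    have hmaps : MapsTo (fun τ : ℝ ↦ 1 - τ) (Icc 0 1) (Icc 0 1) := by
      intro τ hτ
      simp only [mem_Icc] at hτ ⊢
      constructor <;> linarith [hτ.1, hτ.2]
    have hrev : IsTransport g (γ 1) (γ 0) B.symm := by
      refine IsTransport.of_curve (fun τ ↦ γ (1 - τ)) (by simp) (by simp) ?_ _ ?_
      · refine hB.1.comp (ContDiff.contMDiff ?_).contMDiffOn hmaps
        fun_prop
      · intro v
        obtain ⟨s, hs, h0, h1⟩ := hB.2 (B.symm v)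
        refine ⟨_, hs.reverse, ?_, ?_⟩
        · rw [LinearEquiv.apply_symm_apply] at h1
          rw [← h1]
          congr 1
          simp
        · rw [← h0]
          congr 1
          simp
    exact hrev.trans ih

/-- The conformal holonomy group at `x`: parallel transports of the normal tractor connection
along piecewise smooth loops based at `x`. -/
def holonomyGroup (g : SemiRiemannianMetric n M) (x : M) :
    Subgroup (Tractor n x ≃ₗ[ℝ] Tractor n x) where
  carrier := {A | IsTransport g x x A}
  one_mem' := .refl
  mul_mem' hA hB := IsTransport.trans hB hA
  inv_mem' hA := IsTransport.symm hA

end Tractors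

/-! ### The Lie algebra of a linear group -/

section LieAlgebra

variable {V : Type*} [AddCommGroup V] [Module ℝ V]

/-- `A` is the velocity at `0` of a smooth curve `Φ` of automorphisms of `V` that lies in `H` and
starts at the identity; smoothness and velocity are those of the matrix coefficients of `Φ`. -/
def IsVelocity (H : Subgroup (V ≃ₗ[ℝ] V)) (A : Module.End ℝ V) : Prop :=
  ∃ Φ : ℝ → (V ≃ₗ[ℝ] V), (∀ t, Φ t ∈ H) ∧ Φ 0 = 1 ∧
    ∀ (v : V) (l : Module.Dual ℝ V), ContDiff ℝ ∞ (fun t ↦ l (Φ t v)) ∧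
      HasDerivAt (fun t ↦ l (Φ t v)) (l (A v)) 0

theorem IsVelocity.add [FiniteDimensional ℝ V] {H : Subgroup (V ≃ₗ[ℝ] V)} {A B : Module.End ℝ V}
    (hA : IsVelocity H A) (hB : IsVelocity H B) : IsVelocity H (A + B) := by
  obtain ⟨Φ, hΦ, hΦ0, hΦd⟩ := hA
  obtain ⟨Ψ, hΨ, hΨ0, hΨd⟩ := hB
  let b := Module.finBasis ℝ V
  have hexp : ∀ (v : V) (l : Module.Dual ℝ V) (t : ℝ),
      l ((Φ t * Ψ t) v) = ∑ i, b.coord i (Ψ t v) * l (Φ t (b i)) := by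
    intro v l t
    rw [LinearEquiv.mul_apply]
    conv_lhs => rw [← b.sum_repr (Ψ t v)]
    simp only [map_sum, map_smul, smul_eq_mul, Module.Basis.coord_apply]
  refine ⟨fun t ↦ Φ t * Ψ t, fun t ↦ H.mul_mem (hΦ t) (hΨ t), by simp [hΦ0, hΨ0], fun v l ↦ ?_⟩
  simp only [hexp]
  refine ⟨ContDiff.sum fun i _ ↦ (hΨd v (b.coord i)).1.mul (hΦd (b i) l).1, ?_⟩
  have hsum := HasDerivAt.fun_sum (u := Finset.univ) fun i _ ↦
    (hΨd v (b.coord i)).2.mul (hΦd (b i) l).2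
  refine hsum.congr_deriv ?_
  have e1 : ∀ w : V, l w = ∑ i, b.coord i w * l (b i) := fun w ↦ by
    conv_lhs => rw [← b.sum_repr w]
    simp only [map_sum, map_smul, smul_eq_mul, Module.Basis.coord_apply]
  have e2 : l (A v) = ∑ i, b.coord i v * l (A (b i)) := by
    conv_lhs => rw [← b.sum_repr v]
    simp only [map_sum, map_smul, smul_eq_mul, Module.Basis.coord_apply]
  rw [Finset.sum_add_distrib, LinearMap.add_apply, map_add, e1 (B v), e2, add_comm]
  simp [hΦ0, hΨ0]

theorem IsVelocity.smul {H : Subgroup (V ≃ₗ[ℝ] V)} {A : Module.End ℝ V} (c : ℝ)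
    (hA : IsVelocity H A) : IsVelocity H (c • A) := by
  obtain ⟨Φ, hΦ, hΦ0, hΦd⟩ := hA
  refine ⟨fun t ↦ Φ (c * t), fun t ↦ hΦ _, by simp [hΦ0], fun v l ↦ ⟨?_, ?_⟩⟩
  · exact (hΦd v l).1.comp (contDiff_const.mul contDiff_id)
  · have h1 : HasDerivAt (fun t : ℝ ↦ c * t) c 0 := by
      simpa using (hasDerivAt_id (0 : ℝ)).const_mul c
    have h2 : HasDerivAt (fun t ↦ l (Φ t v)) (l (A v)) (c * 0) := by
      simpa using (hΦd v l).2
    have := h2.comp 0 h1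
    simpa [Function.comp_def, mul_comm] using this

/-- The Lie algebra of a linear group `H`: the velocities at the identity of the smooth curves of
automorphisms that lie in `H`. -/
def lieAlgebra [FiniteDimensional ℝ V] (H : Subgroup (V ≃ₗ[ℝ] V)) :
    Submodule ℝ (Module.End ℝ V) where
  carrier := {A | IsVelocity H A}
  zero_mem' := ⟨fun _ ↦ 1, fun _ ↦ H.one_mem, rfl, fun v l ↦
    ⟨contDiff_const, by simpa using hasDerivAt_const (0 : ℝ) (l v)⟩⟩
  add_mem' hA hB := hA.add hB
  smul_mem' c _ hA := hA.smul c

end LieAlgebra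

/-! ### The conformal holonomy distribution -/

section Distribution

variable {n : ℕ} {M : Type*} [TopologicalSpace M] [ChartedSpace (Model n) M]
  [IsManifold (𝓡 n) ∞ M]

/-- The conformal holonomy algebra `𝔥𝔬𝔩ₓ(M,c)`. -/
def holonomyAlgebra (g : SemiRiemannianMetric n M) (x : M) :
    Submodule ℝ (Module.End ℝ (Tractor n x)) :=
  lieAlgebra (holonomyGroup g x)

/-- The identification of `TₓM` with the summand `𝔤₁` of `𝔰𝔬(𝒯ₓ, h)`: the vector `X` goes to the
endomorphism `(α, Y, β) ↦ (g(X,Y), -β X, 0)`. -/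
def gOne (g : SemiRiemannianMetric n M) (x : M) :
    TangentSpace (𝓡 n) x →ₗ[ℝ] Module.End ℝ (Tractor n x) where
  toFun X :=
    { toFun := fun T ↦ (g.val x X T.2.1, -(T.2.2 • X), 0)
      map_add' := fun T T' ↦ by
        refine Prod.ext ?_ (Prod.ext ?_ ?_)
        · simp
        · simp only [Prod.snd_add, Prod.fst_add, add_smul]; abel
        · simp
      map_smul' := fun r T ↦ by
        refine Prod.ext ?_ (Prod.ext ?_ ?_)
        · simp
        · simp [mul_smul]
        · simp }
  map_add' X X' := by
    refine LinearMap.ext fun T ↦ Prod.ext ?_ (Prod.ext ?_ ?_)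
    · simp
    · simp only [LinearMap.coe_mk, AddHom.coe_mk, LinearMap.add_apply, Prod.snd_add,
        Prod.fst_add, smul_add]
      abel
    · simp
  map_smul' r X := by
    refine LinearMap.ext fun T ↦ Prod.ext ?_ (Prod.ext ?_ ?_)
    · simp
    · simp only [LinearMap.coe_mk, AddHom.coe_mk, LinearMap.smul_apply, Prod.smul_snd,
        Prod.smul_fst, RingHom.id_apply, smul_neg]
      rw [smul_comm]
    · simp

/-- The conformal holonomy distribution `ℰₓ = 𝔥𝔬𝔩ₓ(M,c) ∩ 𝔤₁`, as a subspace of `TₓM`. -/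
def holonomyDistribution (g : SemiRiemannianMetric n M) (x : M) :
    Submodule ℝ (TangentSpace (𝓡 n) x) :=
  (holonomyAlgebra g x).comap (gOne g x)

/-- The rank function `r^ℰ`. -/
def rankE (g : SemiRiemannianMetric n M) (x : M) : ℕ :=
  Module.finrank ℝ (holonomyDistribution g x)

/-- `ℰ`-adapted open sets. -/
def IsEAdapted (g : SemiRiemannianMetric n M) (U : Set M) : Prop :=
  IsOpen U ∧ ∃ k : ℕ, (∀ x ∈ U, rankE g x = k) ∧
    ∃ V : Fin k → ∀ x : M, TangentSpace (𝓡 n) x,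
      (∀ i, ContMDiffOn (𝓡 n) (𝓡 n).tangent ∞
        (fun x ↦ (⟨x, V i x⟩ : TangentBundle (𝓡 n) M)) U) ∧
      ∀ x ∈ U, (∀ i, V i x ∈ holonomyDistribution g x) ∧ LinearIndependent ℝ (fun i ↦ V i x)

end Distribution

end ConfHol

end

/-! Parallel transport along a path from `x₀` to `x` conjugates the holonomy algebra at `x₀` onto
the one at `x`. Near `x₀`, transport along the rays of a chart is, in the chart trivialization, an
invertible matrix `U y` depending smoothly on the end point `y`. Hence `X` belongs to `ℰ` at `x` iff
`(U y)⁻¹ ∘ gOneCoord X ∘ U y` lies in one fixed linear subspace `h₀` of the endomorphisms of the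
model fibre. With `h₀` written as the kernel of a linear map, `ℰ` becomes the kernel of a smooth
family of linear maps (`exists_holonomyDistribution_eq_ker`). The only facts used about the holonomy
algebra are that it is a linear subspace and that transport conjugates it.

For such a family the kernels have constant dimension and a smooth frame near any point where their
dimension is minimal (`exists_smooth_frame_ker`). Minimizing over the part of the coordinate
neighbourhood inside the given open set yields the adapted set.

The analytic input is smooth dependence of a linear differential equation on parameters
(`exists_fundamental_solution`). As an integral equation it is linear in the Banach space of
continuous functions on `[0,1]`; its operator depends smoothly on the parameter (`contDiff_curry`)
and is the identity at the base point, and inversion is smooth on the units. -/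

noncomputable section

namespace ConfHol

/-! ### Smooth families as smooth maps into spaces of continuous functions -/

section Curry

open scoped BoundedContinuousFunction

universe u

variable {E F : Type u} {K : Type*} [NormedAddCommGroup E] [NormedSpace ℝ E]
  [NormedAddCommGroup F] [NormedSpace ℝ F] [TopologicalSpace K] [CompactSpace K]

/-- The continuous linear map `h ↦ (s ↦ φ s h)` given by a bounded continuous family `φ` of
continuous linear maps. -/
def applyFamily (φ : K →ᵇ (E →L[ℝ] F)) : E →L[ℝ] (K →ᵇ F) :=
  LinearMap.mkContinuous
    { toFun := fun h ↦ .mkOfCompact ⟨fun s ↦ φ s h, by fun_prop⟩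
      map_add' := fun h h' ↦ by ext s; simp
      map_smul' := fun r h ↦ by ext s; simp } ‖φ‖
    (fun h ↦ by
      rw [BoundedContinuousFunction.norm_le (by positivity)]
      intro s
      exact ((φ s).le_opNorm h).trans (by gcongr; exact φ.norm_coe_le_norm s))

@[simp]
theorem applyFamily_apply (φ : K →ᵇ (E →L[ℝ] F)) (h : E) (s : K) :
    applyFamily φ h s = φ s h := rfl

instance : NormedAddCommGroup (K →ᵇ (E →L[ℝ] F)) :=
  BoundedContinuousFunction.instNormedAddCommGroup

instance : NormedSpace ℝ (K →ᵇ (E →L[ℝ] F)) :=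
  BoundedContinuousFunction.instNormedSpace

/-- The derivative of the curried map is `applyFamily` of the family of partial derivatives; being
bounded linear, `applyFamily` preserves its differentiability class. -/
theorem isBoundedLinearMap_applyFamily :
    IsBoundedLinearMap ℝ (applyFamily : (K →ᵇ (E →L[ℝ] F)) → E →L[ℝ] (K →ᵇ F)) where
  map_add φ φ' := by ext h s; simp
  map_smul r φ := by ext h s; simp
  bound := ⟨1, one_pos, fun φ ↦ by
    rw [one_mul]
    exact LinearMap.mkContinuous_norm_le _ (norm_nonneg _) _⟩

/-- A smooth function of a parameter and of a real variable is a smooth function of the parameter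
with values in the continuous functions on a compact space. -/
theorem contDiff_curry {f : E × ℝ → F} (hf : ContDiff ℝ ∞ f) (p : C(K, ℝ)) (f' : E → K →ᵇ F)
    (hf' : ∀ x s, f' x s = f (x, p s)) : ContDiff ℝ ∞ f' := by
  rw [contDiff_infty]
  intro m
  -- The successor step uses the hypothesis for the target `E →L[ℝ] F` in place of `F`, which is why
  -- `E` and `F` share a universe.
  induction m generalizing F with
  | zero =>
    rw [Nat.cast_zero, contDiff_zero]
    have : f' = fun x ↦ ContinuousMap.isometryEquivBoundedOfCompact K F
        ((⟨fun q : E × K ↦ f (q.1, p q.2), by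
          have := hf.continuous; fun_prop⟩ : C(E × K, F)).curry x) := by
      ext x s; simp [hf']
    rw [this]
    exact (ContinuousMap.isometryEquivBoundedOfCompact K F).continuous.comp
      (ContinuousMap.continuous _)
  | succ m ih =>
    have hdf : ContDiff ℝ ∞ (fun q : E × ℝ ↦ (fderiv ℝ f q).comp (ContinuousLinearMap.inl ℝ E ℝ)) :=
      (hf.fderiv_right (m := ∞) (by simp)).clm_comp contDiff_const
    let d : E → K →ᵇ (E →L[ℝ] F) := fun x ↦ .mkOfCompact
      ⟨fun s ↦ (fderiv ℝ f (x, p s)).comp (ContinuousLinearMap.inl ℝ E ℝ), by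
        have := hdf.continuous
        exact this.comp (by fun_prop : Continuous fun s : K ↦ ((x, p s) : E × ℝ))⟩
    have hd : ContDiff ℝ m d := ih hdf d fun x s ↦ rfl
    rw [Nat.cast_succ, contDiff_succ_iff_hasFDerivAt]
    refine ⟨fun x ↦ applyFamily (d x),
      (isBoundedLinearMap_applyFamily (E := E) (F := F) (K := K)).contDiff.comp hd, fun x ↦ ?_⟩
    rw [hasFDerivAt_iff_isLittleO_nhds_zero, Asymptotics.isLittleO_iff]
    intro c hc
    -- Continuity of `d` in the sup norm bounds the variation of the partial derivative uniformly in
    -- `s`, so the mean value inequality gives a remainder estimate uniform in `s`.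
    have hcont : ContinuousAt d x := hd.continuous.continuousAt
    obtain ⟨r, hr, hball⟩ := Metric.continuousAt_iff.1 hcont c hc
    filter_upwards [Metric.ball_mem_nhds (0 : E) hr] with h hh
    rw [BoundedContinuousFunction.norm_le (by positivity)]
    intro s
    have hpart : ∀ z, HasFDerivAt (fun z ↦ f (z, p s)) (d z s) z := fun z ↦
      ((hf.differentiable (by simp)) (z, p s)).hasFDerivAt.comp z
        (hasFDerivAt_prodMk_left z (p s))
    have hbd : ∀ z ∈ Metric.ball x r, ‖d z s - d x s‖ ≤ c := fun z hz ↦ by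
      have := (BoundedContinuousFunction.dist_coe_le_dist s).trans_lt (hball hz)
      rw [dist_eq_norm] at this
      exact this.le
    have := (convex_ball x r).norm_image_sub_le_of_norm_hasFDerivWithin_le'
      (fun z _ ↦ (hpart z).hasFDerivWithinAt) hbd (Metric.mem_ball_self hr)
      (show x + h ∈ Metric.ball x r by simpa using hh)
    simpa [hf'] using this

end Curry

/-! ### Linear differential equations with parameters -/

section LinearODE

universe u

open MeasureTheory intervalIntegral
open scoped BoundedContinuousFunction

variable {A : Type*} [NormedRing A] [NormedAlgebra ℝ A]

/-- The Volterra operator `f ↦ (t ↦ ∫₀ᵗ f)` on continuous functions on `[0,1]`. -/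
def volterra [CompleteSpace A] : (unitInterval →ᵇ A) →L[ℝ] (unitInterval →ᵇ A) :=
  LinearMap.mkContinuous
    { toFun := fun f ↦ .mkOfCompact ⟨fun t ↦ ∫ s in (0 : ℝ)..t, IccExtend zero_le_one f s, by
        have : Continuous fun t : ℝ ↦ ∫ s in (0 : ℝ)..t, IccExtend zero_le_one f s :=
          continuous_primitive
            (fun a b ↦ (f.continuous.Icc_extend' (h := zero_le_one)).intervalIntegrable a b) 0
        exact this.comp continuous_subtype_val⟩
      map_add' := fun f f' ↦ by
        ext t
        exact integral_add ((f.continuous.Icc_extend' (h := zero_le_one)).intervalIntegrable _ _)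
          ((f'.continuous.Icc_extend' (h := zero_le_one)).intervalIntegrable _ _)
      map_smul' := fun r f ↦ by
        ext t
        exact integral_smul r _ } 1
    (fun f ↦ by
      rw [one_mul, BoundedContinuousFunction.norm_le (by positivity)]
      intro t
      refine (norm_integral_le_of_norm_le_const (C := ‖f‖) fun s _ ↦
        f.norm_coe_le_norm _).trans ?_
      rw [sub_zero, abs_of_nonneg t.2.1]
      exact mul_le_of_le_one_right (norm_nonneg _) t.2.2)

theorem volterra_apply [CompleteSpace A] (f : (unitInterval →ᵇ A)) (t : unitInterval) :
    volterra f t = ∫ s in (0 : ℝ)..t, IccExtend zero_le_one f s := rfl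

/-- A linear differential equation `u' = a(x,t) u` with smooth coefficients that vanish for
`x = x₀` has, for `x` near `x₀`, an invertible fundamental solution, and its value at the time `1`
depends smoothly on `x`. -/
theorem exists_fundamental_solution {E A : Type u} [NormedRing A] [NormedAlgebra ℝ A]
    [CompleteSpace A] [NormedAddCommGroup E] [NormedSpace ℝ E]
    {a : E × ℝ → A} (ha : ContDiff ℝ ∞ a) (x₀ : E) (h0 : ∀ t, a (x₀, t) = 0) :
    ∃ O : Set E, IsOpen O ∧ x₀ ∈ O ∧ ∃ R : E → ℝ → A,
      ContDiffOn ℝ ∞ (fun x ↦ R x 1) O ∧ ∀ x ∈ O, R x 0 = 1 ∧ IsUnit (R x 1) ∧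
        ∀ t ∈ Icc (0 : ℝ) 1, HasDerivWithinAt (R x) (a (x, t) * R x t) (Icc 0 1) t := by
  let a' : E → (unitInterval →ᵇ A) := fun x ↦ .mkOfCompact
    ⟨fun s ↦ a (x, s), by have := ha.continuous; fun_prop⟩
  have ha' : ContDiff ℝ ∞ a' := contDiff_curry ha ⟨Subtype.val, continuous_subtype_val⟩ a'
    fun x s ↦ rfl
  -- The equation with initial value `1` is `T x (S x) = 1`. Since `T x₀ = 1`, the operator `T x` is
  -- a unit for `x` near `x₀`.
  let T : E → ((unitInterval →ᵇ A) →L[ℝ] (unitInterval →ᵇ A)) := fun x ↦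
    1 - volterra.comp (ContinuousLinearMap.mul ℝ (unitInterval →ᵇ A) (a' x))
  have hT : ContDiff ℝ ∞ T := contDiff_const.sub
    (contDiff_const.clm_comp ((ContinuousLinearMap.mul ℝ (unitInterval →ᵇ A)).contDiff.comp ha'))
  have ha0 : a' x₀ = 0 := by ext s; exact h0 s
  have hT0 : T x₀ = 1 := by simp [T, ha0]
  let S : E → (unitInterval →ᵇ A) := fun x ↦ Ring.inverse (T x) 1
  have hTopen : IsOpen {x | IsUnit (T x)} :=
    (Units.isOpen (R := (unitInterval →ᵇ A) →L[ℝ] (unitInterval →ᵇ A))).preimage hT.continuous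
  have hS : ContDiffOn ℝ ∞ S {x | IsUnit (T x)} := fun x hx ↦ by
    obtain ⟨u, hu⟩ := hx
    have h1 : ContDiffAt ℝ ∞ (fun x ↦ Ring.inverse (T x)) x := by
      refine ContDiffAt.comp (g := Ring.inverse) x ?_ hT.contDiffAt
      rw [← hu]
      exact contDiffAt_ringInverse (R := (unitInterval →ᵇ A) →L[ℝ] (unitInterval →ᵇ A)) ℝ u
    exact (h1.clm_apply contDiffAt_const).contDiffWithinAt
  have hS0 : S x₀ = 1 := by simp [S, hT0]
  have hev : ContDiffOn ℝ ∞ (fun x ↦ S x 1) {x | IsUnit (T x)} :=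
    (BoundedContinuousFunction.evalCLM (β := A) ℝ (1 : unitInterval)).contDiff.comp_contDiffOn hS
  -- Invertibility at time `1` is obtained by shrinking the neighbourhood: the value is `1` at `x₀`,
  -- and units form an open set.
  refine ⟨{x | IsUnit (T x)} ∩ (fun x ↦ S x 1) ⁻¹' {u | IsUnit u},
    hev.continuousOn.isOpen_inter_preimage hTopen Units.isOpen, ⟨?_, ?_⟩,
    fun x t ↦ IccExtend zero_le_one (S x) t, ?_, ?_⟩
  · simp [hT0]
  · simp [hS0]
  · refine (hev.mono inter_subset_left).congr fun x _ ↦ ?_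
    exact IccExtend_of_mem _ _ (by simp)
  · rintro x ⟨hx, hx'⟩
    have hfix : ∀ t : unitInterval,
        S x t = 1 + ∫ s in (0 : ℝ)..t, IccExtend zero_le_one (a' x * S x) s := fun t ↦ by
      have h1 : T x (S x) = 1 := by
        change (T x * Ring.inverse (T x)) 1 = 1
        rw [Ring.mul_inverse_cancel _ hx]; rfl
      have h2 := congrArg (fun f : (unitInterval →ᵇ A) ↦ f t) h1
      change S x t - volterra (a' x * S x) t = 1 at h2
      rw [volterra_apply] at h2
      exact sub_eq_iff_eq_add.1 h2
    have hv1 : IccExtend zero_le_one (S x) (1 : ℝ) = S x 1 := IccExtend_of_mem _ _ (by simp)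
    refine ⟨?_, ?_, fun t ht ↦ ?_⟩
    · have := hfix 0
      beta_reduce
      rw [IccExtend_of_mem _ _ (show (0 : ℝ) ∈ Icc 0 1 by simp)]
      simpa using this
    · beta_reduce; rw [hv1]; exact hx'
    · have hc : Continuous (IccExtend (zero_le_one (α := ℝ)) (a' x * S x)) :=
        (a' x * S x).continuous.Icc_extend'
      have hd := (hc.integral_hasStrictDerivAt 0 t).hasDerivAt.const_add (1 : A)
      rw [IccExtend_of_mem _ _ ht] at hd
      beta_reduce
      rw [IccExtend_of_mem _ (S x) ht]
      refine (hd.hasDerivWithinAt (s := Icc 0 1)).congr (fun τ hτ ↦ ?_) ?_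
      · rw [IccExtend_of_mem _ _ hτ]
        exact hfix ⟨τ, hτ⟩
      · rw [IccExtend_of_mem _ _ ht]
        exact hfix ⟨t, ht⟩

end LinearODE

/-! ### Smooth frames of kernels -/

section ConstantRank

theorem finrank_map_of_injective {V W : Type*} [AddCommGroup V] [Module ℝ V] [AddCommGroup W]
    [Module ℝ W] {f : V →ₗ[ℝ] W} (hf : Function.Injective f) (p : Submodule ℝ V) :
    Module.finrank ℝ (p.map f) = Module.finrank ℝ p :=
  (LinearEquiv.finrank_eq (Submodule.equivMapOfInjective f hf p)).symm

variable {E V W : Type*} [NormedAddCommGroup E] [NormedSpace ℝ E]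
  [NormedAddCommGroup V] [NormedSpace ℝ V] [FiniteDimensional ℝ V]
  [NormedAddCommGroup W] [NormedSpace ℝ W]

/-- Every linear map has a generalized inverse. -/
theorem exists_generalized_inverse {V W : Type*} [AddCommGroup V] [Module ℝ V] [AddCommGroup W]
    [Module ℝ W] (L : V →ₗ[ℝ] W) : ∃ B : W →ₗ[ℝ] V, L ∘ₗ B ∘ₗ L = L := by
  obtain ⟨s, hs⟩ := L.rangeRestrict.exists_rightInverse_of_surjective L.range_rangeRestrict
  obtain ⟨q, hq⟩ := (LinearMap.range L).subtype.exists_leftInverse_of_injective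
    (Submodule.ker_subtype _)
  have hLs : ∀ w, L (s w) = w := fun w ↦ congrArg Subtype.val (LinearMap.congr_fun hs w)
  refine ⟨s ∘ₗ q, ?_⟩
  ext v
  have : q (L v) = L.rangeRestrict v := LinearMap.congr_fun hq (L.rangeRestrict v)
  simp [hLs, this]

/-- Every non-empty open set of parameters of a smooth family of linear maps contains a non-empty
open set on which the kernels have a smooth frame. -/
theorem exists_smooth_frame_ker [FiniteDimensional ℝ W] {L : E → V →L[ℝ] W} {O : Set E}
    (hO : IsOpen O) (hne : O.Nonempty) (hL : ContDiffOn ℝ ∞ L O) :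
    ∃ O' ⊆ O, IsOpen O' ∧ O'.Nonempty ∧ ∃ k : ℕ,
      (∀ y ∈ O', Module.finrank ℝ (LinearMap.ker (L y : V →ₗ[ℝ] W)) = k) ∧
      ∃ v : Fin k → E → V, (∀ i, ContDiffOn ℝ ∞ (v i) O') ∧
        ∀ y ∈ O', (∀ i, L y (v i y) = 0) ∧ LinearIndependent ℝ (fun i ↦ v i y) := by
  let r : E → ℕ := fun y ↦ Module.finrank ℝ (LinearMap.ker (L y : V →ₗ[ℝ] W))
  obtain ⟨y₀, hy₀, hmin⟩ : ∃ y₀ ∈ O, ∀ y ∈ O, r y₀ ≤ r y := by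
    have := (measure r).wf.has_min O hne
    obtain ⟨y₀, hy₀, h⟩ := this
    exact ⟨y₀, hy₀, fun y hy ↦ not_lt.1 (h y hy)⟩
  obtain ⟨B, hB1⟩ := exists_generalized_inverse (L y₀ : V →ₗ[ℝ] W)
  let B' : W →L[ℝ] V := B.toContinuousLinearMap
  have hB1' : ∀ v, L y₀ (B' (L y₀ v)) = L y₀ v := fun v ↦ LinearMap.congr_fun hB1 v
  -- On `ker (L y)` this is `1 - B' ∘ L y₀`, which maps into `ker (L y₀)` because `L y₀ ∘ B' ∘ L y₀
  -- = L y₀`. It is the identity at `y₀`, hence invertible nearby.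
  let T : E → (V →L[ℝ] V) := fun y ↦ B'.comp (L y) + (1 - B'.comp (L y₀))
  have hT : ContDiffOn ℝ ∞ T O := (contDiffOn_const.clm_comp hL).add contDiffOn_const
  have hT0 : T y₀ = 1 := by simp [T]
  let O' := O ∩ T ⁻¹' {u | IsUnit u}
  have hO' : IsOpen O' := hT.continuousOn.isOpen_inter_preimage hO Units.isOpen
  have hinv : ContDiffOn ℝ ∞ (fun y ↦ Ring.inverse (T y)) O' := fun y hy ↦ by
    obtain ⟨u, hu⟩ := hy.2
    have h1 : ContDiffAt ℝ ∞ T y := hT.contDiffAt (hO.mem_nhds hy.1)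
    refine (ContDiffAt.comp (g := Ring.inverse) y ?_ h1).contDiffWithinAt
    rw [← hu]
    exact contDiffAt_ringInverse ℝ u
  let b := Module.finBasis ℝ (LinearMap.ker (L y₀ : V →ₗ[ℝ] W))
  have hTinv : ∀ y ∈ O', ∀ w, T y (Ring.inverse (T y) w) = w := fun y hy w ↦ by
    change (T y * Ring.inverse (T y)) w = w
    rw [Ring.mul_inverse_cancel _ hy.2]; rfl
  have hinvT : ∀ y ∈ O', ∀ w, Ring.inverse (T y) (T y w) = w := fun y hy w ↦ by
    change (Ring.inverse (T y) * T y) w = w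
    rw [Ring.inverse_mul_cancel _ hy.2]; rfl
  have hker : ∀ y ∈ O', (LinearMap.ker (L y : V →ₗ[ℝ] W)).map (T y : V →ₗ[ℝ] V) =
      LinearMap.ker (L y₀ : V →ₗ[ℝ] W) := fun y hy ↦ by
    have hinj : Function.Injective (T y : V →ₗ[ℝ] V) :=
      (Function.LeftInverse.injective (hinvT y hy) :)
    refine Submodule.eq_of_le_of_finrank_le ?_ ?_
    · rintro _ ⟨v, hv, rfl⟩
      have hv' : L y v = 0 := hv
      simp [T, hv', hB1']
    -- Minimality of the dimension at `y₀` turns the inclusion into an equality, so `(T y)⁻¹`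
    -- carries a basis of `ker (L y₀)` to a basis of `ker (L y)`.
    · rw [finrank_map_of_injective hinj]
      exact hmin y hy.1
  refine ⟨O', inter_subset_left, hO', ⟨y₀, hy₀, by simp [hT0]⟩, r y₀, fun y hy ↦ ?_,
    fun i y ↦ Ring.inverse (T y) (b i), fun i ↦ hinv.clm_apply contDiffOn_const, fun y hy ↦
      ⟨fun i ↦ ?_, ?_⟩⟩
  · change _ = Module.finrank ℝ (LinearMap.ker (L y₀ : V →ₗ[ℝ] W))
    rw [← hker y hy]
    exact (finrank_map_of_injective (f := (T y : V →ₗ[ℝ] V))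
      (Function.LeftInverse.injective (hinvT y hy) :) _).symm
  · have h1 : (b i : V) ∈ LinearMap.ker (L y₀ : V →ₗ[ℝ] W) := (b i).2
    obtain ⟨v, hv, hv'⟩ := (hker y hy).ge h1
    have h2 : Ring.inverse (T y) (b i : V) = v := by
      rw [← hv']; exact hinvT y hy v
    change L y (Ring.inverse (T y) (b i : V)) = 0
    rw [h2]
    exact hv
  · have hb : LinearIndependent ℝ (fun i ↦ (b i : V)) :=
      b.linearIndependent.map' (Submodule.subtype _) (Submodule.ker_subtype _)
    refine hb.map' (Ring.inverse (T y) : V →L[ℝ] V).toLinearMap (LinearMap.ker_eq_bot.2 ?_)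
    exact (Function.LeftInverse.injective (hTinv y hy) :)

end ConstantRank

/-! ### Conjugation of holonomy algebras by parallel transport -/

section LieAlgebra

variable {V V' : Type*} [AddCommGroup V] [Module ℝ V] [FiniteDimensional ℝ V]
  [AddCommGroup V'] [Module ℝ V'] [FiniteDimensional ℝ V']

/-- A curve in `H` is conjugated pointwise by the fixed map `τ`; the coefficient of the new curve at
`(v, l)` is that of the old one at `(τ⁻¹ v, l ∘ τ)`, so smoothness and velocity carry over. -/
theorem conj_mem_lieAlgebra {H : Subgroup (V ≃ₗ[ℝ] V)} {H' : Subgroup (V' ≃ₗ[ℝ] V')}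
    (τ : V ≃ₗ[ℝ] V') (h : ∀ A ∈ H, (τ.symm.trans A).trans τ ∈ H') {A : Module.End ℝ V}
    (hA : A ∈ lieAlgebra H) : τ.conj A ∈ lieAlgebra H' := by
  obtain ⟨Φ, hΦ, hΦ0, hΦd⟩ := hA
  refine ⟨fun t ↦ (τ.symm.trans (Φ t)).trans τ, fun t ↦ h _ (hΦ t), ?_, fun v l ↦ ?_⟩
  · ext v; simp [hΦ0]
  · exact hΦd (τ.symm v) (l ∘ₗ (τ : V →ₗ[ℝ] V'))

theorem conj_mem_lieAlgebra_iff {H : Subgroup (V ≃ₗ[ℝ] V)} {H' : Subgroup (V' ≃ₗ[ℝ] V')}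
    (τ : V ≃ₗ[ℝ] V') (h : ∀ A ∈ H, (τ.symm.trans A).trans τ ∈ H')
    (h' : ∀ A ∈ H', (τ.trans A).trans τ.symm ∈ H) {A : Module.End ℝ V'} :
    τ.symm.conj A ∈ lieAlgebra H ↔ A ∈ lieAlgebra H' := by
  refine ⟨fun hA ↦ ?_, fun hA ↦ conj_mem_lieAlgebra τ.symm (by simpa using h') hA⟩
  have := conj_mem_lieAlgebra τ h hA
  rwa [LinearEquiv.conj_conj_symm] at this

end LieAlgebra

section HolonomyTransport

variable {n : ℕ} {M : Type*} [TopologicalSpace M] [ChartedSpace (Model n) M]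
  [IsManifold (𝓡 n) ∞ M]

/-- A loop at one end becomes a loop at the other when the path is run before it and backwards after
it. This reduces membership at a variable point to membership at a fixed one. -/
theorem IsTransport.conj_mem_holonomyAlgebra_iff {g : SemiRiemannianMetric n M} {x y : M}
    {τ : Tractor n x ≃ₗ[ℝ] Tractor n y} (hτ : IsTransport g x y τ)
    {A : Module.End ℝ (Tractor n y)} :
    τ.symm.conj A ∈ holonomyAlgebra g x ↔ A ∈ holonomyAlgebra g y :=
  conj_mem_lieAlgebra_iff τ
    (fun _ hA ↦ (hτ.symm.trans hA).trans hτ) (fun _ hA ↦ (hτ.trans hA).trans hτ.symm)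

end HolonomyTransport

/-! ### Smoothness of the curvature quantities in coordinates -/

section Smoothness

variable {n : ℕ} {D : Set (Model n)} {G : Model n → Matrix (Fin n) (Fin n) ℝ}

theorem contDiffOn_det {m : Type*} [Fintype m] [DecidableEq m] {A : Model n → Matrix m m ℝ}
    (hA : ∀ i j, ContDiffOn ℝ ∞ (fun y ↦ A y i j) D) :
    ContDiffOn ℝ ∞ (fun y ↦ (A y).det) D := by
  simp only [Matrix.det_apply']
  exact ContDiffOn.sum fun σ _ ↦ contDiffOn_const.mul (contDiffOn_prod fun i _ ↦ hA _ _)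

/-- Cramer's rule: the entries are quotients of determinants that are polynomial in the entries of
`G`. -/
theorem contDiffOn_inv_apply (hG : ∀ i j, ContDiffOn ℝ ∞ (fun y ↦ G y i j) D)
    (hdet : ∀ y ∈ D, (G y).det ≠ 0) (i j : Fin n) : ContDiffOn ℝ ∞ (fun y ↦ (G y)⁻¹ i j) D := by
  simp only [Matrix.inv_def, Ring.inverse_eq_inv', Matrix.smul_apply, Matrix.adjugate_apply,
    smul_eq_mul]
  refine ((contDiffOn_det hG).inv hdet).mul (contDiffOn_det fun k l ↦ ?_)
  by_cases hk : k = j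
  · subst hk
    simpa using contDiffOn_const
  · simpa [Matrix.updateRow_ne hk] using hG k l

theorem contDiffOn_partialDeriv (hD : IsOpen D) {f : Model n → ℝ} (hf : ContDiffOn ℝ ∞ f D)
    (k : Fin n) : ContDiffOn ℝ ∞ (partialDeriv k f) D :=
  (hf.fderiv_of_isOpen hD (m := ∞) (by simp)).clm_apply contDiffOn_const

theorem contDiffOn_christoffel (hD : IsOpen D) (hG : ∀ i j, ContDiffOn ℝ ∞ (fun y ↦ G y i j) D)
    (hdet : ∀ y ∈ D, (G y).det ≠ 0) (k i j : Fin n) :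
    ContDiffOn ℝ ∞ (christoffel G k i j) D :=
  contDiffOn_const.mul <| ContDiffOn.sum fun l _ ↦ (contDiffOn_inv_apply hG hdet k l).mul <|
    ((contDiffOn_partialDeriv hD (hG j l) i).add (contDiffOn_partialDeriv hD (hG i l) j)).sub
      (contDiffOn_partialDeriv hD (hG i j) l)

theorem contDiffOn_ricci (hD : IsOpen D) (hG : ∀ i j, ContDiffOn ℝ ∞ (fun y ↦ G y i j) D)
    (hdet : ∀ y ∈ D, (G y).det ≠ 0) (i j : Fin n) : ContDiffOn ℝ ∞ (ricci G i j) D := by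
  have hΓ := contDiffOn_christoffel hD hG hdet
  exact ContDiffOn.sum fun k _ ↦ ((contDiffOn_partialDeriv hD (hΓ k i j) k).sub
    (contDiffOn_partialDeriv hD (hΓ k k j) i)).add <| ContDiffOn.sum fun m _ ↦
      ((hΓ k k m).mul (hΓ m i j)).sub ((hΓ k i m).mul (hΓ m k j))

theorem contDiffOn_schouten (hD : IsOpen D) (hG : ∀ i j, ContDiffOn ℝ ∞ (fun y ↦ G y i j) D)
    (hdet : ∀ y ∈ D, (G y).det ≠ 0) (i j : Fin n) : ContDiffOn ℝ ∞ (schouten G i j) D := by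
  have hR := contDiffOn_ricci hD hG hdet
  have hs : ContDiffOn ℝ ∞ (scal G) D := ContDiffOn.sum fun i _ ↦ ContDiffOn.sum fun j _ ↦
    (contDiffOn_inv_apply hG hdet i j).mul (hR i j)
  exact contDiffOn_const.mul ((hR i j).sub ((hs.div_const _).mul (hG i j)))

end Smoothness

/-! ### Tangent vectors and the metric in a chart -/

section Gram

variable {n : ℕ} {M : Type*} [TopologicalSpace M] [ChartedSpace (Model n) M]
  [IsManifold (𝓡 n) ∞ M]

theorem contMDiffOn_mfderiv_extChartAt_symm (x₀ : M) {O : Set (Model n)}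
    (hO : O ⊆ (extChartAt (𝓡 n) x₀).target) {v : Model n → Model n} (hv : ContDiffOn ℝ ∞ v O) :
    ContMDiffOn 𝓘(ℝ, Model n) (𝓡 n).tangent ∞
      (fun y ↦ (⟨(extChartAt (𝓡 n) x₀).symm y,
        mfderiv 𝓘(ℝ, Model n) (𝓡 n) (extChartAt (𝓡 n) x₀).symm y (v y)⟩ :
          TangentBundle (𝓡 n) M)) O := by
  have hopen := isOpen_extChartAt_target (I := 𝓡 n) x₀
  have h1 := (contMDiffOn_extChartAt_symm (I := 𝓡 n) (n := ∞) x₀).contMDiffOn_tangentMapWithin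
    (m := ∞) (by simp) hopen.uniqueMDiffOn
  have h2 : ContMDiffOn 𝓘(ℝ, Model n) 𝓘(ℝ, Model n).tangent ∞
      (fun y ↦ (⟨y, v y⟩ : TangentBundle 𝓘(ℝ, Model n) (Model n))) O :=
    contMDiffOn_vectorSpace_iff_contDiffOn.2 hv
  refine (h1.comp h2 fun y hy ↦ hO hy).congr fun y hy ↦ ?_
  simp only [Function.comp_apply, tangentMapWithin]
  rw [mfderivWithin_of_isOpen hopen (hO hy)]

theorem components_mfderiv_symm (x₀ : M) {y : Model n} (hy : y ∈ (extChartAt (𝓡 n) x₀).target)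
    (v : Model n) :
    components x₀ ((extChartAt (𝓡 n) x₀).symm y)
      (mfderiv 𝓘(ℝ, Model n) (𝓡 n) (extChartAt (𝓡 n) x₀).symm y v) = v := by
  have h := mfderiv_extChartAt_comp_mfderivWithin_extChartAt_symm (I := 𝓡 n) hy
  rw [ModelWithCorners.range_eq_univ, mfderivWithin_univ] at h
  have := DFunLike.congr_fun h v
  ext k
  exact congrArg (fun w : Model n ↦ w k) this

theorem mfderiv_symm_components (x₀ : M) {y : Model n} (hy : y ∈ (extChartAt (𝓡 n) x₀).target)
    (X : TangentSpace (𝓡 n) ((extChartAt (𝓡 n) x₀).symm y)) :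
    mfderiv 𝓘(ℝ, Model n) (𝓡 n) (extChartAt (𝓡 n) x₀).symm y
      (WithLp.toLp 2 (components x₀ _ X) : Model n) = X := by
  have h := mfderivWithin_extChartAt_symm_comp_mfderiv_extChartAt (I := 𝓡 n) hy
  rw [ModelWithCorners.range_eq_univ, mfderivWithin_univ] at h
  exact DFunLike.congr_fun h X

/-- The components of tangent vectors in a chart, as a linear equivalence. -/
def componentsEquiv (x₀ : M) {x : M} (hx : x ∈ (extChartAt (𝓡 n) x₀).source) :
    TangentSpace (𝓡 n) x ≃ₗ[ℝ] (Fin n → ℝ) :=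
  LinearEquiv.ofBijective
    { toFun := components x₀ x
      map_add' := fun X Y ↦ by
        ext k
        exact congrArg (fun w : Model n ↦ w k) (map_add _ X Y)
      map_smul' := fun r X ↦ by
        ext k
        exact congrArg (fun w : Model n ↦ w k) (map_smul _ r X) } (by
    obtain ⟨y, hy, rfl⟩ : ∃ y ∈ (extChartAt (𝓡 n) x₀).target, (extChartAt (𝓡 n) x₀).symm y = x :=
      ⟨_, (extChartAt (𝓡 n) x₀).map_source hx, (extChartAt (𝓡 n) x₀).left_inv hx⟩
    refine ⟨fun X Y h ↦ ?_, fun w ↦ ⟨_, components_mfderiv_symm x₀ hy (WithLp.toLp 2 w)⟩⟩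
    change components x₀ _ X = components x₀ _ Y at h
    rw [← mfderiv_symm_components x₀ hy X, h, mfderiv_symm_components x₀ hy])

@[simp]
theorem componentsEquiv_apply (x₀ : M) {x : M} (hx : x ∈ (extChartAt (𝓡 n) x₀).source)
    (X : TangentSpace (𝓡 n) x) : componentsEquiv x₀ hx X = components x₀ x X := rfl

theorem val_eq_sum_gram (g : SemiRiemannianMetric n M) (x₀ : M) {x : M}
    (hx : x ∈ (extChartAt (𝓡 n) x₀).source) (X Y : TangentSpace (𝓡 n) x) :
    g.val x X Y = ∑ i, ∑ j, gram g x₀ (extChartAt (𝓡 n) x₀ x) i j * components x₀ x X i *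
      components x₀ x Y j := by
  obtain ⟨y, hy, rfl⟩ : ∃ y ∈ (extChartAt (𝓡 n) x₀).target, (extChartAt (𝓡 n) x₀).symm y = x :=
    ⟨_, (extChartAt (𝓡 n) x₀).map_source hx, (extChartAt (𝓡 n) x₀).left_inv hx⟩
  rw [(extChartAt (𝓡 n) x₀).right_inv hy]
  have hsum : ∀ X, X = ∑ i, components x₀ _ X i •
      mfderiv 𝓘(ℝ, Model n) (𝓡 n) (extChartAt (𝓡 n) x₀).symm y
        (EuclideanSpace.single i (1 : ℝ)) := fun X ↦ by
    conv_lhs => rw [← mfderiv_symm_components x₀ hy X]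
    have : (WithLp.toLp 2 (components x₀ _ X) : Model n) =
        ∑ i, components x₀ _ X i • EuclideanSpace.single i (1 : ℝ) := by
      ext k; simp [Pi.single_apply]
    rw [this]
    erw [map_sum]
    exact Finset.sum_congr rfl fun i _ ↦ map_smul _ _ _
  conv_lhs => rw [hsum X, hsum Y]
  simp only [map_sum, map_smul, sum_apply, smul_apply,
    smul_eq_mul, gram]
  simp only [Finset.mul_sum]
  rw [Finset.sum_comm]
  exact Finset.sum_congr rfl fun i _ ↦ Finset.sum_congr rfl fun j _ ↦ by ring

/-- The smooth section `g` is evaluated on two smooth coordinate fields along the inverse chart; the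
entry is the fibre coordinate of the resulting section of the trivial line bundle. -/
theorem contDiffOn_gram (g : SemiRiemannianMetric n M) (x₀ : M) (i j : Fin n) :
    ContDiffOn ℝ ∞ (fun y ↦ gram g x₀ y i j) (extChartAt (𝓡 n) x₀).target := by
  rw [← contMDiffOn_iff_contDiffOn]
  have hs := contMDiffOn_extChartAt_symm (I := 𝓡 n) (n := ∞) x₀
  have hv := fun i : Fin n ↦ contMDiffOn_mfderiv_extChartAt_symm x₀ Subset.rfl
    (v := fun _ ↦ EuclideanSpace.single i (1 : ℝ)) contDiffOn_const
  intro y hy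
  have : ContMDiffWithinAt 𝓘(ℝ, Model n) ((𝓡 n).prod 𝓘(ℝ)) ∞
      (fun y ↦ TotalSpace.mk' ℝ (E := Bundle.Trivial M ℝ) ((extChartAt (𝓡 n) x₀).symm y)
        (gram g x₀ y i j)) (extChartAt (𝓡 n) x₀).target y := by
    apply ContMDiffWithinAt.clm_bundle_apply₂ (F₁ := Model n) (F₂ := Model n)
    · exact ContMDiffAt.comp_contMDiffWithinAt y g.contMDiff.contMDiffAt (hs y hy)
    · exact hv i y hy
    · exact hv j y hy
  simp only [contMDiffWithinAt_totalSpace] at this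
  exact this.2

theorem det_gram_ne_zero (g : SemiRiemannianMetric n M) (x₀ : M) {y : Model n}
    (hy : y ∈ (extChartAt (𝓡 n) x₀).target) : (gram g x₀ y).det ≠ 0 := by
  intro h
  -- A null vector of a singular Gram matrix gives the components of a tangent vector orthogonal to
  -- everything.
  obtain ⟨v, hv, hv'⟩ := Matrix.exists_vecMul_eq_zero_iff.2 h
  have hx := (extChartAt (𝓡 n) x₀).map_target hy
  let e := componentsEquiv x₀ hx
  apply hv
  have : e.symm v = 0 := by
    refine g.nondegenerate _ _ fun w ↦ ?_
    rw [val_eq_sum_gram g x₀ hx, (extChartAt (𝓡 n) x₀).right_inv hy, Finset.sum_comm]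
    have h1 : components x₀ _ (e.symm v) = v := e.apply_symm_apply v
    refine Finset.sum_eq_zero fun j _ ↦ ?_
    rw [← Finset.sum_mul, h1]
    have h2 := congrFun hv' j
    simp only [Matrix.vecMul, dotProduct, Pi.zero_apply] at h2
    simp only [mul_comm (gram g x₀ y _ j), h2, zero_mul]
  exact e.symm.map_eq_zero_iff.1 this

end Gram

/-- The model fibre of the standard tractor bundle. -/
abbrev TractorModel (n : ℕ) : Type := ℝ × (Fin n → ℝ) × ℝ

/-! ### The tractor connection in a chart -/

section ConnectionForm

variable {n : ℕ}

/-- The right-hand side of the parallelism equation at the point `y` in the direction `h`, as an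
endomorphism of the model fibre. -/
def connectionForm (G : Model n → Matrix (Fin n) (Fin n) ℝ) (y h : Model n) :
    TractorModel n →L[ℝ] TractorModel n :=
  LinearMap.toContinuousLinearMap
    { toFun := fun u ↦ (∑ i, ∑ j, schouten G i j y * h i * u.2.1 j,
        fun k ↦ -(∑ i, ∑ j, christoffel G k i j y * h i * u.2.1 j) - u.1 * h k
          - u.2.2 * ∑ i, ∑ l, (G y)⁻¹ k l * schouten G i l y * h i,
        ∑ i, ∑ j, G y i j * h i * u.2.1 j)
      map_add' := fun u v ↦ by
        refine Prod.ext ?_ (Prod.ext (funext fun k ↦ ?_) ?_) <;>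
        simp only [Prod.fst_add, Prod.snd_add, Pi.add_apply, mul_add, Finset.sum_add_distrib]
        ring
      map_smul' := fun r u ↦ by
        have key : ∀ c : Fin n → Fin n → ℝ, ∑ i, ∑ j, c i j * h i * (r * u.2.1 j) =
            r * ∑ i, ∑ j, c i j * h i * u.2.1 j := fun c ↦ by
          simp only [Finset.mul_sum]
          exact Finset.sum_congr rfl fun i _ ↦ Finset.sum_congr rfl fun j _ ↦ by ring
        refine Prod.ext ?_ (Prod.ext (funext fun k ↦ ?_) ?_) <;>
        simp only [Prod.smul_fst, Prod.smul_snd, Pi.smul_apply, smul_eq_mul, key,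
          RingHom.id_apply]
        · ring
        · exact key (G y) }

theorem connectionForm_apply (G : Model n → Matrix (Fin n) (Fin n) ℝ) (y h : Model n)
    (u : TractorModel n) : connectionForm G y h u =
      (∑ i, ∑ j, schouten G i j y * h i * u.2.1 j,
        fun k ↦ -(∑ i, ∑ j, christoffel G k i j y * h i * u.2.1 j) - u.1 * h k
          - u.2.2 * ∑ i, ∑ l, (G y)⁻¹ k l * schouten G i l y * h i,
        ∑ i, ∑ j, G y i j * h i * u.2.1 j) := rfl

/-- The ray ending at its own starting point has velocity zero, so this supplies the vanishing of
the coefficients that `exists_fundamental_solution` asks for. -/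
theorem connectionForm_zero (G : Model n → Matrix (Fin n) (Fin n) ℝ) (y : Model n) :
    connectionForm G y 0 = 0 := by
  ext u <;> simp [connectionForm_apply]

theorem contDiffOn_connectionForm {D : Set (Model n)} (hD : IsOpen D)
    {G : Model n → Matrix (Fin n) (Fin n) ℝ} (hG : ∀ i j, ContDiffOn ℝ ∞ (fun y ↦ G y i j) D)
    (hdet : ∀ y ∈ D, (G y).det ≠ 0) :
    ContDiffOn ℝ ∞ (fun p : Model n × Model n ↦ connectionForm G p.1 p.2) (D ×ˢ univ) := by
  rw [contDiffOn_clm_apply]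
  intro u
  simp only [connectionForm_apply]
  have lift : ∀ {f : Model n → ℝ}, ContDiffOn ℝ ∞ f D →
      ContDiffOn ℝ ∞ (fun p : Model n × Model n ↦ f p.1) (D ×ˢ univ) := fun hf ↦
    hf.comp contDiffOn_fst fun p hp ↦ hp.1
  have hh : ∀ i, ContDiffOn ℝ ∞ (fun p : Model n × Model n ↦ p.2 i) (D ×ˢ univ) := fun i ↦ by
    fun_prop
  have hP := fun i j ↦ lift (contDiffOn_schouten hD hG hdet i j)
  have hΓ := fun k i j ↦ lift (contDiffOn_christoffel hD hG hdet k i j)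
  have hI := fun i j ↦ lift (contDiffOn_inv_apply hG hdet i j)
  refine ContDiffOn.prodMk ?_ (ContDiffOn.prodMk (contDiffOn_pi.2 fun k ↦ ?_) ?_)
  · exact ContDiffOn.sum fun i _ ↦ ContDiffOn.sum fun j _ ↦
      ((hP i j).mul (hh i)).mul contDiffOn_const
  · exact ((ContDiffOn.sum fun i _ ↦ ContDiffOn.sum fun j _ ↦
      ((hΓ k i j).mul (hh i)).mul contDiffOn_const).neg.sub (contDiffOn_const.mul (hh k))).sub
        (contDiffOn_const.mul (ContDiffOn.sum fun i _ ↦ ContDiffOn.sum fun l _ ↦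
          ((hI k l).mul (hP i l)).mul (hh i)))
  · exact ContDiffOn.sum fun i _ ↦ ContDiffOn.sum fun j _ ↦
      ((lift (hG i j)).mul (hh i)).mul contDiffOn_const

end ConnectionForm

/-! ### Extension by a bump function -/

section Cutoff

variable {E E' F : Type*} [NormedAddCommGroup E] [NormedSpace ℝ E] [FiniteDimensional ℝ E]
  [NormedAddCommGroup E'] [NormedSpace ℝ E'] [NormedAddCommGroup F] [NormedSpace ℝ F]

/-- A function that is smooth for `y` in a neighbourhood of `y₀` agrees near `y₀` with a function
that is smooth everywhere. -/
theorem exists_contDiff_eq_near {D : Set E} (hD : IsOpen D) {y₀ : E} (hy₀ : y₀ ∈ D)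
    {f : E × E' → F} (hf : ContDiffOn ℝ ∞ f (D ×ˢ univ)) :
    ∃ r > 0, Metric.ball y₀ r ⊆ D ∧ ∃ χ : E → ℝ, ContDiff ℝ ∞ (fun p ↦ χ p.1 • f p) ∧
      ∀ y ∈ Metric.ball y₀ r, χ y = 1 := by
  obtain ⟨R, hR, hball⟩ := Metric.isOpen_iff.1 hD y₀ hy₀
  let χ : ContDiffBump y₀ := ⟨R / 3, R / 2, by positivity, by linarith⟩
  refine ⟨R / 3, by positivity, (Metric.ball_subset_ball (by linarith)).trans hball, χ, ?_,
    fun y hy ↦ χ.one_of_mem_closedBall (Metric.ball_subset_closedBall hy)⟩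
  rw [contDiff_iff_contDiffAt]
  intro p
  by_cases hp : p.1 ∈ D
  · exact (χ.contDiff.contDiffAt.comp p contDiffAt_fst).smul
      (hf.contDiffAt ((hD.prod isOpen_univ).mem_nhds ⟨hp, trivial⟩))
  -- The support is the closed ball of radius `R / 2`, inside `D`; off `D` the product therefore
  -- vanishes locally, whatever `f` does there.
  · have h1 : p.1 ∉ tsupport χ := fun h ↦ by
      rw [χ.tsupport_eq] at h
      exact hp (hball (Metric.closedBall_subset_ball (show R / 2 < R by linarith) h))
    have h2 : (χ : E → ℝ) =ᶠ[𝓝 p.1] 0 := notMem_tsupport_iff_eventuallyEq.1 h1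
    refine (contDiffAt_const (c := (0 : F))).congr_of_eventuallyEq ?_
    filter_upwards [continuousAt_fst.eventually h2] with q hq
    rw [hq]
    simp

end Cutoff

/-! ### Radial parallel transport -/

section Transport

variable {n : ℕ} {M : Type*} [TopologicalSpace M] [ChartedSpace (Model n) M]
  [IsManifold (𝓡 n) ∞ M]

/-- The trivialization of the standard tractor bundle over a coordinate domain. -/
def tractorTriv (x₀ : M) {x : M} (hx : x ∈ (extChartAt (𝓡 n) x₀).source) :
    Tractor n x ≃ₗ[ℝ] TractorModel n :=
  (LinearEquiv.refl ℝ ℝ).prodCongr ((componentsEquiv x₀ hx).prodCongr (LinearEquiv.refl ℝ ℝ))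

theorem tractorTriv_apply (x₀ : M) {x : M} (hx : x ∈ (extChartAt (𝓡 n) x₀).source)
    (v : Tractor n x) : tractorTriv x₀ hx v = (v.1, components x₀ x v.2.1, v.2.2) := rfl

theorem heq_of_tractorTriv_eq (x₀ : M) {x x' : M} (h : x = x')
    (hx : x ∈ (extChartAt (𝓡 n) x₀).source) (hx' : x' ∈ (extChartAt (𝓡 n) x₀).source)
    {v : Tractor n x} {w : Tractor n x'} (hvw : tractorTriv x₀ hx v = tractorTriv x₀ hx' w) :
    HEq v w := by
  subst h
  exact heq_of_eq ((tractorTriv x₀ hx).injective hvw)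

/-- The tractor at `ψ(y)` with the components `u` in the chart with inverse `ψ`. -/
def tractorOfModel (x₀ : M) (y : Model n) (u : TractorModel n) :
    Tractor n ((extChartAt (𝓡 n) x₀).symm y) :=
  (u.1, mfderiv 𝓘(ℝ, Model n) (𝓡 n) (extChartAt (𝓡 n) x₀).symm y (WithLp.toLp 2 u.2.1 : Model n),
    u.2.2)

theorem components_tractorOfModel (x₀ : M) {y : Model n} (hy : y ∈ (extChartAt (𝓡 n) x₀).target)
    (u : TractorModel n) :
    components x₀ ((extChartAt (𝓡 n) x₀).symm y) (tractorOfModel x₀ y u).2.1 = u.2.1 :=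
  components_mfderiv_symm x₀ hy (WithLp.toLp 2 u.2.1)

/-- A solution of the coordinate equation along a segment in a chart is parallel. -/
theorem parallelEquation_segment (g : SemiRiemannianMetric n M) (x₀ : M) {y₀ h : Model n}
    (hseg : ∀ t ∈ Icc (0 : ℝ) 1, y₀ + t • h ∈ (extChartAt (𝓡 n) x₀).target)
    {u : ℝ → TractorModel n} {t : ℝ} (ht : t ∈ Icc (0 : ℝ) 1)
    (hu : HasDerivWithinAt u (connectionForm (gram g x₀) (y₀ + t • h) h (u t)) (Icc 0 1) t) :
    ParallelEquation g x₀ (fun τ ↦ (extChartAt (𝓡 n) x₀).symm (y₀ + τ • h))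
      (fun τ ↦ tractorOfModel x₀ (y₀ + τ • h) (u τ)) t := by
  have hinv : ∀ τ ∈ Icc (0 : ℝ) 1,
      extChartAt (𝓡 n) x₀ ((extChartAt (𝓡 n) x₀).symm (y₀ + τ • h)) = y₀ + τ • h :=
    fun τ hτ ↦ (extChartAt (𝓡 n) x₀).right_inv (hseg τ hτ)
  have hder : derivWithin
      (fun τ : ℝ ↦ extChartAt (𝓡 n) x₀ ((extChartAt (𝓡 n) x₀).symm (y₀ + τ • h))) (Icc 0 1) t
        = h := by
    rw [derivWithin_congr hinv (hinv t ht)]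
    have : HasDerivAt (fun τ : ℝ ↦ y₀ + τ • h) h t := by
      simpa using ((hasDerivAt_id t).smul_const h).const_add y₀
    exact this.hasDerivWithinAt.derivWithin (uniqueDiffOn_Icc zero_lt_one t ht)
  have hcomp : ∀ τ ∈ Icc (0 : ℝ) 1, components x₀ _ (tractorOfModel x₀ (y₀ + τ • h) (u τ)).2.1 =
      (u τ).2.1 := fun τ hτ ↦ components_tractorOfModel x₀ (hseg τ hτ) _
  rw [connectionForm_apply] at hu
  unfold ParallelEquation
  simp only [hder, hinv t ht, hcomp t ht]
  refine ⟨(hasFDerivAt_fst.comp_hasDerivWithinAt t hu :), fun k ↦ ?_,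
    ((hasFDerivAt_snd.comp (u t) hasFDerivAt_snd).comp_hasDerivWithinAt t hu :)⟩
  have h1 := (hasFDerivAt_fst.comp (u t) hasFDerivAt_snd).comp_hasDerivWithinAt t hu
  have h2 := hasDerivWithinAt_pi.1 h1 k
  refine HasDerivWithinAt.congr h2 (fun τ hτ ↦ ?_) ?_
  · rw [hcomp τ hτ]; rfl
  · rw [hcomp t ht]; rfl

/-- Parallel transport along the rays of a chart depends smoothly on the end point. -/
theorem exists_smooth_transport (g : SemiRiemannianMetric n M) (x₀ : M) :
    ∃ O : Set (Model n), IsOpen O ∧ O ⊆ (extChartAt (𝓡 n) x₀).target ∧ extChartAt (𝓡 n) x₀ x₀ ∈ O ∧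
      ∃ U : Model n → (TractorModel n →L[ℝ] TractorModel n), ContDiffOn ℝ ∞ U O ∧
        ∀ (x : M) (hx : x ∈ (extChartAt (𝓡 n) x₀).source), extChartAt (𝓡 n) x₀ x ∈ O →
          IsUnit (U (extChartAt (𝓡 n) x₀ x)) ∧
          ∃ τ : Tractor n x₀ ≃ₗ[ℝ] Tractor n x, IsTransport g x₀ x τ ∧
            ∀ v, tractorTriv x₀ hx (τ v) =
              U (extChartAt (𝓡 n) x₀ x) (tractorTriv x₀ (mem_extChartAt_source x₀) v) := by
  set y₀ := extChartAt (𝓡 n) x₀ x₀ with hy₀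
  have hD := isOpen_extChartAt_target (I := 𝓡 n) x₀
  obtain ⟨r, hr, hball, χ, hχ, hχ1⟩ := exists_contDiff_eq_near hD (mem_extChartAt_target x₀)
    (contDiffOn_connectionForm hD (contDiffOn_gram g x₀) fun y hy ↦ det_gram_ne_zero g x₀ hy)
  -- Coefficients of the parallelism equation along the ray `t ↦ y₀ + t • (y - y₀)`, with the end
  -- point `y = p.1` as parameter. The cutoff makes them smooth for all `y`, and it equals `1` along
  -- rays inside the ball.
  let a : Model n × ℝ → (TractorModel n →L[ℝ] TractorModel n) := fun p ↦
    χ (y₀ + p.2 • (p.1 - y₀)) • connectionForm (gram g x₀) (y₀ + p.2 • (p.1 - y₀)) (p.1 - y₀)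
  have ha : ContDiff ℝ ∞ a :=
    hχ.comp (g := fun p : Model n × Model n ↦ χ p.1 • connectionForm (gram g x₀) p.1 p.2)
      (f := fun p : Model n × ℝ ↦ (y₀ + p.2 • (p.1 - y₀), p.1 - y₀)) (by fun_prop)
  obtain ⟨O, hO, hyO, R, hR, hRO⟩ := exists_fundamental_solution ha y₀ fun t ↦ by
    simp [a, connectionForm_zero]
  refine ⟨O ∩ Metric.ball y₀ r, hO.inter Metric.isOpen_ball, inter_subset_right.trans hball,
    ⟨hyO, Metric.mem_ball_self hr⟩, fun y ↦ R y 1, hR.mono inter_subset_left, ?_⟩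
  rintro x hx ⟨hxO, hxr⟩
  set y := extChartAt (𝓡 n) x₀ x with hy
  obtain ⟨h0, hunit, hode⟩ := hRO y hxO
  refine ⟨hunit, ?_⟩
  have hseg : ∀ t ∈ Icc (0 : ℝ) 1, y₀ + t • (y - y₀) ∈ Metric.ball y₀ r := fun t ht ↦
    (convex_ball y₀ r).add_smul_sub_mem (Metric.mem_ball_self hr) hxr ht
  obtain ⟨w, hw⟩ := hunit
  let W : TractorModel n ≃ₗ[ℝ] TractorModel n :=
    (ContinuousLinearEquiv.unitsEquiv ℝ (TractorModel n) w).toLinearEquiv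
  have hW : ∀ u, W u = R y 1 u := fun u ↦ by rw [← hw]; rfl
  let τ : Tractor n x₀ ≃ₗ[ℝ] Tractor n x :=
    ((tractorTriv x₀ (mem_extChartAt_source x₀)).trans W).trans (tractorTriv x₀ hx).symm
  have hτ : ∀ v, tractorTriv x₀ hx (τ v) =
      R y 1 (tractorTriv x₀ (mem_extChartAt_source x₀) v) := fun v ↦ by
    simp [τ, hW]
  refine ⟨τ, ?_, hτ⟩
  have hγ0 : (extChartAt (𝓡 n) x₀).symm (y₀ + (0 : ℝ) • (y - y₀)) = x₀ := by
    simp [hy₀]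
  have hγ1 : (extChartAt (𝓡 n) x₀).symm (y₀ + (1 : ℝ) • (y - y₀)) = x := by
    rw [one_smul, add_sub_cancel, hy, (extChartAt (𝓡 n) x₀).left_inv hx]
  have htriv : ∀ (t : ℝ), t ∈ Icc (0 : ℝ) 1 → ∀ u hz, tractorTriv x₀ hz
      (tractorOfModel x₀ (y₀ + t • (y - y₀)) u) = u := fun t ht u hz ↦ by
    rw [tractorTriv_apply, components_tractorOfModel x₀ (hball (hseg t ht))]
    rfl
  have hsrc : ∀ t ∈ Icc (0 : ℝ) 1,
      (extChartAt (𝓡 n) x₀).symm (y₀ + t • (y - y₀)) ∈ (extChartAt (𝓡 n) x₀).source := fun t ht ↦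
    (extChartAt (𝓡 n) x₀).map_target (hball (hseg t ht))
  refine IsTransport.of_curve (fun t : ℝ ↦ (extChartAt (𝓡 n) x₀).symm (y₀ + t • (y - y₀))) hγ0 hγ1
    ?_ τ fun v ↦ ⟨fun t ↦ tractorOfModel x₀ (y₀ + t • (y - y₀))
      (R y t (tractorTriv x₀ (mem_extChartAt_source x₀) v)), ?_, ?_, ?_⟩
  · refine (contMDiffOn_extChartAt_symm (I := 𝓡 n) (n := ∞) x₀).comp
      (f := fun t : ℝ ↦ y₀ + t • (y - y₀)) ?_ fun t ht ↦ hball (hseg t ht)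
    rw [contMDiffOn_iff_contDiffOn]
    fun_prop
  · intro t₀ ht₀
    refine ⟨x₀, by simpa using hsrc t₀ ht₀, ?_⟩
    filter_upwards [self_mem_nhdsWithin] with t ht
    refine parallelEquation_segment g x₀ (fun t ht ↦ hball (hseg t ht)) ht ?_
    have h1 := (hode t ht).clm_apply (hasDerivWithinAt_const t (Icc 0 1)
      (tractorTriv x₀ (mem_extChartAt_source x₀) v))
    simpa [a, hχ1 _ (hseg t ht)] using h1
  · refine heq_of_tractorTriv_eq x₀ hγ0 (hsrc 0 (by simp)) (mem_extChartAt_source x₀) ?_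
    rw [htriv 0 (by simp), h0]
    rfl
  · refine heq_of_tractorTriv_eq x₀ hγ1 (hsrc 1 (by simp)) hx ?_
    rw [htriv 1 (by simp), hτ]

end Transport

/-! ### The summand `𝔤₁` in coordinates -/

section Coordinates

variable {n : ℕ}

/-- The endomorphism `(α, Y, β) ↦ (g(X,Y), -β X, 0)` of the model fibre. -/
def gOneCoord (G : Matrix (Fin n) (Fin n) ℝ) :
    (Fin n → ℝ) →ₗ[ℝ] TractorModel n →ₗ[ℝ] TractorModel n :=
  LinearMap.mk₂ ℝ (fun X u ↦ (∑ i, ∑ j, G i j * X i * u.2.1 j, -(u.2.2 • X), 0))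
    (fun X X' u ↦ by
      refine Prod.ext ?_ (Prod.ext ?_ ?_)
      · simp [mul_add, add_mul, Finset.sum_add_distrib]
      · simp [add_comm]
      · simp)
    (fun r X u ↦ by
      refine Prod.ext ?_ (Prod.ext ?_ ?_)
      · simp only [Prod.smul_fst, Pi.smul_apply, smul_eq_mul, Finset.mul_sum]
        exact Finset.sum_congr rfl fun i _ ↦ Finset.sum_congr rfl fun j _ ↦ by ring
      · change -(u.2.2 • r • X) = r • -(u.2.2 • X)
        rw [smul_neg, smul_comm]
      · simp)
    (fun X u u' ↦ by
      refine Prod.ext ?_ (Prod.ext ?_ ?_)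
      · simp [mul_add, Finset.sum_add_distrib]
      · simp [add_smul, add_comm]
      · simp)
    (fun r X u ↦ by
      refine Prod.ext ?_ (Prod.ext ?_ ?_)
      · simp only [Prod.smul_fst, Prod.smul_snd, Pi.smul_apply, smul_eq_mul, Finset.mul_sum]
        exact Finset.sum_congr rfl fun i _ ↦ Finset.sum_congr rfl fun j _ ↦ by ring
      · simp [mul_smul]
      · simp)

theorem gOneCoord_apply (G : Matrix (Fin n) (Fin n) ℝ) (X : Fin n → ℝ) (u : TractorModel n) :
    gOneCoord G X u = (∑ i, ∑ j, G i j * X i * u.2.1 j, -(u.2.2 • X), 0) := rfl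

theorem contDiffOn_gOneCoord {D : Set (Model n)} {G : Model n → Matrix (Fin n) (Fin n) ℝ}
    (hG : ∀ i j, ContDiffOn ℝ ∞ (fun y ↦ G y i j) D) (X : Fin n → ℝ) :
    ContDiffOn ℝ ∞ (fun y ↦ (gOneCoord (G y) X).toContinuousLinearMap) D := by
  rw [contDiffOn_clm_apply]
  intro u
  exact ContDiffOn.prodMk (ContDiffOn.sum fun i _ ↦ ContDiffOn.sum fun j _ ↦
    ((hG i j).mul contDiffOn_const).mul contDiffOn_const) contDiffOn_const

/-- Every subspace of a finite-dimensional space is the kernel of a linear endomorphism. -/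
theorem exists_ker_eq {V : Type*} [AddCommGroup V] [Module ℝ V] (p : Submodule ℝ V) :
    ∃ q : V →ₗ[ℝ] V, LinearMap.ker q = p := by
  obtain ⟨p', h⟩ := p.exists_isCompl
  refine ⟨p'.subtype ∘ₗ p'.projectionOnto p h.symm, ?_⟩
  rw [LinearMap.ker_comp_of_ker_eq_bot _ (Submodule.ker_subtype _),
    Submodule.ker_projectionOnto]

end Coordinates

/-! ### The holonomy distribution as a smooth family of kernels -/

section Distribution

variable {n : ℕ} {M : Type*} [TopologicalSpace M] [ChartedSpace (Model n) M]
  [IsManifold (𝓡 n) ∞ M]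

theorem tractorTriv_gOne (g : SemiRiemannianMetric n M) (x₀ : M) {x : M}
    (hx : x ∈ (extChartAt (𝓡 n) x₀).source) (X : TangentSpace (𝓡 n) x) (v : Tractor n x) :
    tractorTriv x₀ hx (gOne g x X v) =
      gOneCoord (gram g x₀ (extChartAt (𝓡 n) x₀ x)) (components x₀ x X) (tractorTriv x₀ hx v) := by
  have h1 : gOne g x X v = (g.val x X v.2.1, -(v.2.2 • X), 0) := rfl
  have h2 : components x₀ x (-(v.2.2 • X)) = -(v.2.2 • components x₀ x X) := by
    simp only [← componentsEquiv_apply x₀ hx, map_neg, map_smul]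
  rw [h1, tractorTriv_apply, tractorTriv_apply, gOneCoord_apply, val_eq_sum_gram g x₀ hx, h2]

theorem contMDiffOn_componentsEquiv_symm (x₀ : M) {O : Set (Model n)}
    (hO : O ⊆ (extChartAt (𝓡 n) x₀).target) {v : Model n → Fin n → ℝ}
    (hv : ContDiffOn ℝ ∞ v O) {V : ∀ x : M, TangentSpace (𝓡 n) x} {S : Set M}
    (hS : S ⊆ (extChartAt (𝓡 n) x₀).source) (hSO : MapsTo (extChartAt (𝓡 n) x₀) S O)
    (hV : ∀ x (hx : x ∈ S), V x =
      (componentsEquiv x₀ (hS hx)).symm (v (extChartAt (𝓡 n) x₀ x))) :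
    ContMDiffOn (𝓡 n) (𝓡 n).tangent ∞ (fun x ↦ (⟨x, V x⟩ : TangentBundle (𝓡 n) M)) S := by
  have h1 := contMDiffOn_mfderiv_extChartAt_symm x₀ hO
    (v := fun y ↦ WithLp.toLp 2 (v y)) (by fun_prop)
  have h2 : ContMDiffOn (𝓡 n) 𝓘(ℝ, Model n) ∞ (extChartAt (𝓡 n) x₀) S :=
    (contMDiffOn_extChartAt (I := 𝓡 n) (n := ∞) (x := x₀)).mono fun x hx ↦ by
      simpa using hS hx
  refine (h1.comp h2 hSO).congr fun x hx ↦ ?_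
  have hx' := hS hx
  rw [hV x hx]
  -- `x` and its image under the chart and back are only propositionally equal, so the vectors are
  -- compared in the total space; a general `w` allows `x` to be substituted.
  have key : ∀ w : Fin n → ℝ,
      (⟨x, (componentsEquiv x₀ hx').symm w⟩ : TangentBundle (𝓡 n) M) =
        ⟨(extChartAt (𝓡 n) x₀).symm (extChartAt (𝓡 n) x₀ x),
          mfderiv 𝓘(ℝ, Model n) (𝓡 n) (extChartAt (𝓡 n) x₀).symm (extChartAt (𝓡 n) x₀ x)
            (WithLp.toLp 2 w : Model n)⟩ := by
    intro w
    obtain ⟨y, hy, rfl⟩ : ∃ y ∈ (extChartAt (𝓡 n) x₀).target, (extChartAt (𝓡 n) x₀).symm y = x :=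
      ⟨_, (extChartAt (𝓡 n) x₀).map_source hx', (extChartAt (𝓡 n) x₀).left_inv hx'⟩
    rw [(extChartAt (𝓡 n) x₀).right_inv hy]
    congr 1
    rw [LinearEquiv.symm_apply_eq]
    exact (components_mfderiv_symm x₀ hy (WithLp.toLp 2 w)).symm
  exact key _

/-- In a coordinate neighbourhood, the holonomy distribution is the kernel of a smooth family of
linear maps. -/
theorem exists_holonomyDistribution_eq_ker (g : SemiRiemannianMetric n M) (x₀ : M) :
    ∃ O : Set (Model n), IsOpen O ∧ O ⊆ (extChartAt (𝓡 n) x₀).target ∧ extChartAt (𝓡 n) x₀ x₀ ∈ O ∧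
      ∃ L : Model n → (Fin n → ℝ) →L[ℝ] (TractorModel n →L[ℝ] TractorModel n),
        ContDiffOn ℝ ∞ L O ∧ ∀ x ∈ (extChartAt (𝓡 n) x₀).source, extChartAt (𝓡 n) x₀ x ∈ O →
          ∀ X, X ∈ holonomyDistribution g x ↔
            L (extChartAt (𝓡 n) x₀ x) (components x₀ x X) = 0 := by
  obtain ⟨O, hO, hOt, hyO, U, hU, hUO⟩ := exists_smooth_transport g x₀
  let e := tractorTriv x₀ (mem_extChartAt_source (I := 𝓡 n) x₀)
  let h₀ : Submodule ℝ (TractorModel n →L[ℝ] TractorModel n) :=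
    (holonomyAlgebra g x₀).comap
      (e.symm.conj.toLinearMap ∘ₗ ContinuousLinearMap.coeLM ℝ)
  obtain ⟨q, hq⟩ := exists_ker_eq h₀
  let q' : (TractorModel n →L[ℝ] TractorModel n) →L[ℝ] (TractorModel n →L[ℝ] TractorModel n) :=
    q.toContinuousLinearMap
  let A : Model n → (Fin n → ℝ) →ₗ[ℝ] (TractorModel n →L[ℝ] TractorModel n) := fun y ↦
    { toFun := fun X ↦ q' (Ring.inverse (U y) *
        (gOneCoord (gram g x₀ y) X).toContinuousLinearMap * U y)
      map_add' := fun X X' ↦ by simp only [map_add, mul_add, add_mul]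
      map_smul' := fun r X ↦ by
        simp only [map_smul, mul_smul_comm, smul_mul_assoc, RingHom.id_apply] }
  have hunit : ∀ y ∈ O, IsUnit (U y) := fun y hy ↦ by
    have := (hUO _ ((extChartAt (𝓡 n) x₀).map_target (hOt hy)) (by
      rwa [(extChartAt (𝓡 n) x₀).right_inv (hOt hy)])).1
    rwa [(extChartAt (𝓡 n) x₀).right_inv (hOt hy)] at this
  refine ⟨O, hO, hOt, hyO, fun y ↦ (A y).toContinuousLinearMap, ?_, fun x hx hxO X ↦ ?_⟩
  · rw [contDiffOn_clm_apply]
    intro X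
    have hinv : ContDiffOn ℝ ∞ (fun y ↦ Ring.inverse (U y)) O := fun y hy ↦ by
      obtain ⟨u, hu⟩ := hunit y hy
      have h1 : ContDiffAt ℝ ∞ U y := hU.contDiffAt (hO.mem_nhds hy)
      refine (ContDiffAt.comp (g := Ring.inverse) y ?_ h1).contDiffWithinAt
      rw [← hu]
      exact contDiffAt_ringInverse ℝ u
    have hG := contDiffOn_gOneCoord (fun i j ↦ (contDiffOn_gram g x₀ i j).mono hOt) X
    exact q'.contDiff.comp_contDiffOn ((hinv.mul hG).mul hU)
  · obtain ⟨hu, τ, hτ, hτU⟩ := hUO x hx hxO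
    set y := extChartAt (𝓡 n) x₀ x
    have h1 : X ∈ holonomyDistribution g x ↔ τ.symm.conj (gOne g x X) ∈ holonomyAlgebra g x₀ :=
      hτ.conj_mem_holonomyAlgebra_iff.symm
    have h2 : (A y).toContinuousLinearMap (components x₀ x X) = 0 ↔
        Ring.inverse (U y) *
          (gOneCoord (gram g x₀ y) (components x₀ x X)).toContinuousLinearMap * U y ∈ h₀ := by
      rw [← hq]; rfl
    rw [h1, h2]
    -- In the trivialization `τ` is `U y`, so the matrix expression is the element of `𝔤₁` given by
    -- `X`, pulled back to `x₀` along the ray.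
    have h3 : e.symm.conj ((Ring.inverse (U y) *
        (gOneCoord (gram g x₀ y) (components x₀ x X)).toContinuousLinearMap * U y :
          TractorModel n →L[ℝ] TractorModel n) : TractorModel n →ₗ[ℝ] TractorModel n) =
        τ.symm.conj (gOne g x X) := by
      refine LinearMap.ext fun v ↦ ?_
      have h4 : ∀ u, Ring.inverse (U y) (U y u) = u := fun u ↦ by
        change (Ring.inverse (U y) * U y) u = u
        rw [Ring.inverse_mul_cancel _ hu]; rfl
      have h5 : U y (e v) = tractorTriv x₀ hx (τ v) := (hτU v).symm
      have h6 : gOneCoord (gram g x₀ y) (components x₀ x X) (U y (e v)) =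
          U y (e (τ.symm (gOne g x X (τ v)))) := by
        rw [h5, ← tractorTriv_gOne, ← hτU, LinearEquiv.apply_symm_apply]
      change e.symm (Ring.inverse (U y) (gOneCoord (gram g x₀ y) (components x₀ x X)
        (U y (e v)))) = τ.symm (gOne g x X (τ v))
      rw [h6, h4, LinearEquiv.symm_apply_apply]
    rw [← h3]
    rfl

theorem exists_isEAdapted_subset (g : SemiRiemannianMetric n M) {U : Set M} (hU : IsOpen U)
    (hne : U.Nonempty) : ∃ V : Set M, V ⊆ U ∧ V.Nonempty ∧ IsEAdapted g V := by
  obtain ⟨x₀, hx₀⟩ := hne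
  obtain ⟨O, hO, hOt, hyO, L, hL, hLO⟩ := exists_holonomyDistribution_eq_ker g x₀
  have hsymm := continuousOn_extChartAt_symm (I := 𝓡 n) x₀
  obtain ⟨O', hO'O, hO', ⟨y, hy⟩, k, hk, v, hv, hvk⟩ := exists_smooth_frame_ker
    (O := O ∩ (extChartAt (𝓡 n) x₀).symm ⁻¹' U) (L := L)
    ((hsymm.mono hOt).isOpen_inter_preimage hO hU)
    ⟨_, hyO, by simpa using hx₀⟩ (hL.mono inter_subset_left)
  have hO't : O' ⊆ (extChartAt (𝓡 n) x₀).target := fun y hy ↦ hOt (hO'O hy).1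
  let S := (extChartAt (𝓡 n) x₀).source ∩ extChartAt (𝓡 n) x₀ ⁻¹' O'
  have hS : ∀ x ∈ S, ∀ X, X ∈ holonomyDistribution g x ↔
      L (extChartAt (𝓡 n) x₀ x) (components x₀ x X) = 0 := fun x hx ↦
    hLO x hx.1 (hO'O hx.2).1
  classical
  -- The value `0` off the chart domain is a mere default: the fields matter only on `S`, which lies
  -- in that domain.
  let V : Fin k → ∀ x : M, TangentSpace (𝓡 n) x := fun i x ↦
    if hx : x ∈ (extChartAt (𝓡 n) x₀).source then
      (componentsEquiv x₀ hx).symm (v i (extChartAt (𝓡 n) x₀ x)) else 0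
  have hV : ∀ i x (hx : x ∈ S), V i x =
      (componentsEquiv x₀ hx.1).symm (v i (extChartAt (𝓡 n) x₀ x)) := fun i x hx ↦ dif_pos hx.1
  refine ⟨S, fun x hx ↦ ?_, ⟨(extChartAt (𝓡 n) x₀).symm y, ?_, ?_⟩,
    (continuousOn_extChartAt x₀).isOpen_inter_preimage (isOpen_extChartAt_source x₀) hO',
    k, fun x hx ↦ ?_, V, fun i ↦ ?_, fun x hx ↦ ⟨fun i ↦ ?_, ?_⟩⟩
  · have := (hO'O hx.2).2
    rwa [mem_preimage, (extChartAt (𝓡 n) x₀).left_inv hx.1] at this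
  · exact (extChartAt (𝓡 n) x₀).map_target (hO't hy)
  · rwa [mem_preimage, (extChartAt (𝓡 n) x₀).right_inv (hO't hy)]
  · have h1 : holonomyDistribution g x = (LinearMap.ker (L (extChartAt (𝓡 n) x₀ x) :
        (Fin n → ℝ) →ₗ[ℝ] (TractorModel n →L[ℝ] TractorModel n))).comap
          (componentsEquiv x₀ hx.1).toLinearMap :=
      Submodule.ext fun X ↦ hS x hx X
    rw [← hk _ hx.2, rankE, h1,
      ← LinearEquiv.finrank_map_eq (componentsEquiv x₀ hx.1).symm,
      Submodule.map_equiv_eq_comap_symm, LinearEquiv.symm_symm]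
  · exact contMDiffOn_componentsEquiv_symm x₀ hO't (hv i) inter_subset_left (fun x hx ↦ hx.2)
      (hV i)
  · rw [hS x hx, hV i x hx, ← componentsEquiv_apply x₀ hx.1, LinearEquiv.apply_symm_apply]
    exact (hvk _ hx.2).1 i
  · simp only [hV _ x hx]
    exact (hvk _ hx.2).2.map' (componentsEquiv x₀ hx.1).symm.toLinearMap (LinearEquiv.ker _)

end Distribution

end ConfHol

end

/-! ### Existence of adapted sets and density of their union -/

theorem mainTheorem6 (n : ℕ) (hn : 3 ≤ n) (M : Type*) [TopologicalSpace M] [T2Space M]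
    [SecondCountableTopology M] [ChartedSpace (ConfHol.Model n) M] [IsManifold (𝓡 n) ∞ M]
    (c : Set (ConfHol.SemiRiemannianMetric n M)) (hc : ConfHol.IsConformalStructure c)
    (g : ConfHol.SemiRiemannianMetric n M) (hg : g ∈ c) :
    (∀ U : Set M, IsOpen U → U.Nonempty →
      ∃ V : Set M, V ⊆ U ∧ V.Nonempty ∧ ConfHol.IsEAdapted g V) ∧
    IsOpen (⋃₀ {V : Set M | ConfHol.IsEAdapted g V}) ∧
    Dense (⋃₀ {V : Set M | ConfHol.IsEAdapted g V}) := by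
  refine ⟨fun U hU hne ↦ ConfHol.exists_isEAdapted_subset g hU hne,
    isOpen_sUnion fun V hV ↦ hV.1, dense_iff_inter_open.2 fun U hU hne ↦ ?_⟩
  obtain ⟨V, hVU, ⟨x, hx⟩, hV⟩ := ConfHol.exists_isEAdapted_subset g hU hne
  exact ⟨x, hVU hx, V, hV, hx⟩
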